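/- Let $m\in\mathbb{C}$ with $\operatorname{Re} m<1$, let $\mathbb{H}^+=\{(x,y)\in\mathbb{R}^2 : x>0\}$, and let $u:\mathbb{R}\to\mathbb{R}$ be continuous and bounded. Call $U\in C^2(\mathbb{H}^+,\mathbb{C})$ an axisymmetric potential if $\partial_{xx}U+\partial_{yy}U+\frac{m}{x}\partial_xU=0$ on $\mathbb{H}^+$. Put $$C_m=\frac{1}{2^m\pi}\,\frac{\Gamma\left(1-\frac m2\right)^2}{\Gamma(1-m)},\qquad P(x,y)=C_m\,x^{1-m}\int_{-\infty}^{\infty}\frac{u(\eta)\,d\eta}{\left(x^2+(y-\eta)^2\right)^{1-\frac m2}}\qquad((x,y)\in\mathbb{H}^+).$$ Then: 1. $C_m=\frac{1-m}{2\pi}\int_0^\pi\sin^{1-m}\theta\,d\theta$. 2. The integral defining $P$ converges absolutely on $\mathbb{H}^+$, $P$ is an axisymmetric potential, and $\lim_{(x',y')\to(0,y)}P(x',y')=u(y)$ for every $y\in\mathbb{R}$ (the limit being taken in $\mathbb{H}^+$). 3. There is a unique axisymmetric potential $U$ on $\mathbb{H}^+$ such that $U(x,y)\to0$ as $\|(x,y)\|\to+\infty$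 in $\mathbb{H}^+$ and $\lim_{(x',y')\to(0,y)}U(x',y')=u(y)$ for every $y\in\mathbb{R}$ if and only if $u(y)\to0$ as $|y|\to\infty$. 4. Every axisymmetric potential $U$ as in 3 is given by the Poisson formula: $U=P$ on $\mathbb{H}^+$. -/

import Mathlib

open Filter Topology MeasureTheory

noncomputable section

/-- The right half-plane `{(x, y) : x > 0}`. -/
def rightHalfPlane : Set (ℝ × ℝ) := {p | 0 < p.1}

/-- The partial derivative with respect to the first variable. -/
def partialX (U : ℝ × ℝ → ℂ) (p : ℝ × ℝ) : ℂ := deriv (fun t : ℝ => U (t, p.2)) p.1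

/-- The partial derivative with respect to the second variable. -/
def partialY (U : ℝ × ℝ → ℂ) (p : ℝ × ℝ) : ℂ := deriv (fun t : ℝ => U (p.1, t)) p.2

/-- The Weinstein operator `L_m U = ∂ₓₓ U + ∂ᵧᵧ U + (m / x) ∂ₓ U`. -/
def weinsteinOp (m : ℂ) (U : ℝ × ℝ → ℂ) (p : ℝ × ℝ) : ℂ :=
  partialX (partialX U) p + partialY (partialY U) p + m / (p.1 : ℂ) * partialX U p

/-- `U` is (on the right half-plane) an axisymmetric potential of class `C²`. Only the values of
`U` on the right half-plane matter. -/
def IsAxisymmetricPotential (m : ℂ) (U : ℝ × ℝ → ℂ) : Prop :=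
  ContDiffOn ℝ 2 U rightHalfPlane ∧ ∀ p ∈ rightHalfPlane, weinsteinOp m U p = 0

/-- For every real `y`, `U` tends to `u y` at `(0, y)`, from within the right half-plane. -/
def HasBoundaryValues (U : ℝ × ℝ → ℂ) (u : ℝ → ℝ) : Prop :=
  ∀ y : ℝ, Tendsto U (𝓝[rightHalfPlane] ((0 : ℝ), y)) (𝓝 (u y : ℂ))

/-- `U(x, y)` tends to `0` as `‖(x, y)‖ → ∞` within the right half-plane. -/
def VanishesAtInfinity (U : ℝ × ℝ → ℂ) : Prop :=
  Tendsto U (cocompact (ℝ × ℝ) ⊓ 𝓟 rightHalfPlane) (𝓝 0)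

/-- `U` is an axisymmetric potential on the right half-plane with boundary values `u` on the
`y`-axis, and it tends to `0` at infinity. -/
def IsDirichletSolution (m : ℂ) (u : ℝ → ℝ) (U : ℝ × ℝ → ℂ) : Prop :=
  IsAxisymmetricPotential m U ∧ VanishesAtInfinity U ∧ HasBoundaryValues U u

/-- The constant `C_m = Γ(1 - m/2)² / (2^m π Γ(1 - m))`. -/
def poissonConst (m : ℂ) : ℂ :=
  Complex.Gamma (1 - m / 2) ^ 2 / ((2 : ℂ) ^ m * (Real.pi : ℂ) * Complex.Gamma (1 - m))

/-- The integrand `u(η) / (x² + (y - η)²)^(1 - m/2)` of the Poisson formula. -/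
def poissonIntegrand (m : ℂ) (u : ℝ → ℝ) (p : ℝ × ℝ) (η : ℝ) : ℂ :=
  (u η : ℂ) / ((p.1 ^ 2 + (p.2 - η) ^ 2 : ℝ) : ℂ) ^ (1 - m / 2)

/-- The Poisson integral `C_m x^(1 - m) ∫ u(η) / (x² + (y - η)²)^(1 - m/2) dη`. -/
def poissonIntegral (m : ℂ) (u : ℝ → ℝ) (p : ℝ × ℝ) : ℂ :=
  poissonConst m * (p.1 : ℂ) ^ (1 - m) * ∫ η : ℝ, poissonIntegrand m u p η

end

noncomputable section

/-! Existence is a kernel computation. Sine powers reduce to beta integrals, which gives the second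
form of `C_m` and, through the duplication formula, `C_m ∫ (1 + s²)^(-(1 - m/2)) ds = 1`
(`poissonConst_mul_integral`). The kernels `(y - η)^j (x² + (y - η)²)^(-s)` form a family closed
under differentiation, so the equation for `P` becomes an algebraic identity between their
integrals. Substituting `η = y - x s` gives `P = C_m ∫ u(y - x s) (1 + s²)^(-(1 - m/2)) ds`;
dominated convergence and the normalization yield the boundary values. Splitting the integral at
`|η| = R` gives decay at infinity when `u → 0`; conversely, decay of any solution forces `u → 0` by
passing to the boundary.

Uniqueness cannot rest on a maximum principle, since `m` is complex. Instead, let `W` be a solution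
with zero data, extended by `0` to a bounded continuous function on the plane. The formal adjoint of
the operator, applied to `x E(x) B(y)`, is `(x E'' + (2 - m) E') B + x E B''`: the factor `x`
removes the singularity. `W` is orthogonal to all such functions, even if `E(0) ≠ 0`
(`integral_mul_adjointTest_eq_zero`). For Gaussians this says that `F(l) = ∫∫ W x exp(-l (x² + (y -
b)²))` satisfies `l F' = -(2 - m/2) F`, so `l^(2 - m/2) F(l)` is constant. Boundedness of `W` gives
`|F(l)| ≤ A l^(-3/2)`, and `Re (2 - m/2) > 3/2`, so letting `l → 0` forces `F = 0`
(`gaussianMoment_eq_zero`). Gaussians with all centres and enough widths generate a point-separating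
algebra, so `W = 0` (`eq_zero_of_gaussianMoment`). -/

theorem Complex.ofReal_sq_cpow {r : ℝ} (hr : 0 < r) (c : ℂ) :
    ((r ^ 2 : ℝ) : ℂ) ^ c = (r : ℂ) ^ (2 * c) := by
  have : ((r ^ 2 : ℝ) : ℂ) ^ c = (((r : ℝ) : ℂ) * ((r : ℝ) : ℂ)) ^ c := by push_cast; rw [sq]
  rw [this, Complex.mul_cpow_ofReal_nonneg hr.le hr.le,
    ← Complex.cpow_add _ _ (by exact_mod_cast hr.ne'), two_mul]

/-! ### Sine integrals and the Poisson constant -/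

theorem image_half_one_sub_cos :
    (fun θ : ℝ => (1 - Real.cos θ) / 2) '' Set.Ioo 0 Real.pi = Set.Ioo 0 1 := by
  ext x
  constructor
  · rintro ⟨θ, ⟨h0, h1⟩, rfl⟩
    have hs : 0 < Real.sin θ := Real.sin_pos_of_pos_of_lt_pi h0 h1
    have h := Real.sin_sq_add_cos_sq θ
    constructor <;> dsimp only <;> nlinarith
  · rintro ⟨h0, h1⟩
    refine ⟨Real.arccos (1 - 2 * x), ⟨Real.arccos_pos.2 (by linarith), ?_⟩, ?_⟩
    · refine lt_of_le_of_ne (Real.arccos_le_pi _) fun h => ?_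
      have := Real.arccos_eq_pi.1 h
      linarith
    · dsimp only
      rw [Real.cos_arccos (by linarith) (by linarith)]
      ring

/-- Substitute `x = (1 - cos θ) / 2` in the beta integral: `x (1 - x) = (sin θ / 2)²` and `dx = (sin
θ / 2) dθ`. No condition on `a` is needed, because the change of variables along an injective map is
valid without integrability. -/
theorem integral_sin_cpow (a : ℂ) :
    ∫ θ in (0 : ℝ)..Real.pi, (Real.sin θ : ℂ) ^ a =
      (2 : ℂ) ^ a * Complex.betaIntegral ((a + 1) / 2) ((a + 1) / 2) := by
  have hderiv : ∀ θ ∈ Set.Ioo 0 Real.pi,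
      HasDerivWithinAt (fun θ : ℝ => (1 - Real.cos θ) / 2) (Real.sin θ / 2)
        (Set.Ioo 0 Real.pi) θ := fun θ _ => by
    simpa using ((Real.hasDerivAt_cos θ).const_sub 1 |>.div_const 2).hasDerivWithinAt
  have hinj : Set.InjOn (fun θ : ℝ => (1 - Real.cos θ) / 2) (Set.Ioo 0 Real.pi) := by
    intro x hx y hy hxy
    refine Real.injOn_cos ⟨hx.1.le, hx.2.le⟩ ⟨hy.1.le, hy.2.le⟩ ?_
    dsimp only at hxy
    linarith
  have key := integral_image_eq_integral_abs_deriv_smul measurableSet_Ioo hderiv hinj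
    (fun x : ℝ => (x : ℂ) ^ ((a + 1) / 2 - 1) * (1 - (x : ℂ)) ^ ((a + 1) / 2 - 1))
  rw [image_half_one_sub_cos] at key
  rw [Complex.betaIntegral, intervalIntegral.integral_of_le zero_le_one,
    intervalIntegral.integral_of_le Real.pi_pos.le, integral_Ioc_eq_integral_Ioo,
    integral_Ioc_eq_integral_Ioo, key, ← integral_const_mul]
  refine setIntegral_congr_fun measurableSet_Ioo fun θ hθ => ?_
  have hs : 0 < Real.sin θ := Real.sin_pos_of_pos_of_lt_pi hθ.1 hθ.2
  have hs2 : 0 < Real.sin θ / 2 := by positivity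
  have h := Real.sin_sq_add_cos_sq θ
  have hc1 : 0 ≤ (1 - Real.cos θ) / 2 := by nlinarith
  have hc2 : 0 ≤ (1 + Real.cos θ) / 2 := by nlinarith
  have e1 : (1 : ℂ) - (((1 - Real.cos θ) / 2 : ℝ) : ℂ) = (((1 + Real.cos θ) / 2 : ℝ) : ℂ) := by
    push_cast; ring
  rw [e1, ← Complex.mul_cpow_ofReal_nonneg hc1 hc2, ← Complex.ofReal_mul,
    show (1 - Real.cos θ) / 2 * ((1 + Real.cos θ) / 2) = (Real.sin θ / 2) ^ 2 by nlinarith,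
    Complex.ofReal_sq_cpow hs2, abs_of_pos hs2, Complex.real_smul,
    show 2 * ((a + 1) / 2 - 1) = a - 1 by ring,
    Complex.cpow_sub _ _ (by exact_mod_cast hs2.ne'), Complex.cpow_one,
    mul_div_cancel₀ _ (by exact_mod_cast hs2.ne'),
    show (2 : ℂ) ^ a = ((2 : ℝ) : ℂ) ^ a by norm_cast,
    ← Complex.mul_cpow_ofReal_nonneg (by norm_num) hs2.le, ← Complex.ofReal_mul,
    mul_div_cancel₀ _ (by norm_num)]

theorem integral_sin_cpow_eq_Gamma {a : ℂ} (ha : -1 < a.re) :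
    ∫ θ in (0 : ℝ)..Real.pi, (Real.sin θ : ℂ) ^ a =
      (2 : ℂ) ^ a * Complex.Gamma ((a + 1) / 2) ^ 2 / Complex.Gamma (a + 1) := by
  have h2 : 0 < ((a + 1) / 2).re := by
    rw [show (a + 1) / 2 = (a + 1) / ((2 : ℝ) : ℂ) by push_cast; rfl, Complex.div_ofReal_re]
    simp; linarith
  have := Complex.Gamma_mul_Gamma_eq_betaIntegral h2 h2
  rw [add_halves] at this
  rw [integral_sin_cpow, eq_div_iff, sq, this]
  · ring
  · apply Complex.Gamma_ne_zero_of_re_pos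
    simp; linarith

/-- Put `s = tan θ`, so that `1 + s² = (cos θ)⁻²` and `ds = (cos θ)⁻² dθ`; a shift by `π / 2` turns
the cosine into a sine. -/
theorem integral_one_add_sq_cpow (p : ℂ) :
    ∫ s : ℝ, ((1 + s ^ 2 : ℝ) : ℂ) ^ (-p) =
      ∫ θ in (0 : ℝ)..Real.pi, (Real.sin θ : ℂ) ^ (2 * p - 2) := by
  have hcos : ∀ θ ∈ Set.Ioo (-(Real.pi / 2)) (Real.pi / 2), 0 < Real.cos θ :=
    fun θ hθ => Real.cos_pos_of_mem_Ioo hθ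
  have key := integral_image_eq_integral_abs_deriv_smul measurableSet_Ioo
    (fun θ hθ => (Real.hasDerivAt_tan (hcos θ hθ).ne').hasDerivWithinAt) Real.injOn_tan
    (fun s : ℝ => ((1 + s ^ 2 : ℝ) : ℂ) ^ (-p))
  rw [Real.image_tan_Ioo, setIntegral_univ] at key
  rw [key]
  have hshift := intervalIntegral.integral_comp_sub_right (a := 0) (b := Real.pi)
    (fun θ : ℝ => (Real.cos θ : ℂ) ^ (2 * p - 2)) (Real.pi / 2)
  simp only [Real.cos_sub_pi_div_two] at hshift
  rw [hshift, zero_sub, show Real.pi - Real.pi / 2 = Real.pi / 2 by ring,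
    intervalIntegral.integral_of_le (by linarith [Real.pi_pos]), integral_Ioc_eq_integral_Ioo]
  refine setIntegral_congr_fun measurableSet_Ioo fun θ hθ => ?_
  have hc := hcos θ hθ
  have hc' : (Real.cos θ : ℂ) ≠ 0 := by exact_mod_cast hc.ne'
  have e : 1 + Real.tan θ ^ 2 = ((Real.cos θ)⁻¹) ^ 2 := by
    rw [inv_pow, ← Real.inv_one_add_tan_sq hc.ne', inv_inv]
  rw [e, Complex.ofReal_sq_cpow (by positivity), abs_of_pos (by positivity), Complex.real_smul,
    Complex.ofReal_inv, Complex.inv_cpow, mul_neg, Complex.cpow_neg, inv_inv,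
    Complex.cpow_sub _ _ hc']
  · have : (Real.cos θ : ℂ) ^ (2 : ℂ) = (Real.cos θ : ℂ) ^ 2 := by
      exact_mod_cast Complex.cpow_natCast (Real.cos θ : ℂ) 2
    rw [this]
    push_cast
    ring
  · rw [Complex.arg_ofReal_of_nonneg hc.le]
    exact Real.pi_pos.ne

theorem poissonConst_eq_integral_sin {m : ℂ} (hm : m.re < 1) :
    poissonConst m =
      (1 - m) / (2 * (Real.pi : ℂ)) *
        ∫ θ in (0 : ℝ)..Real.pi, (Real.sin θ : ℂ) ^ (1 - m) := by
  have h1 : (1 : ℂ) - m ≠ 0 := fun h => by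
    have := congrArg Complex.re h
    simp at this; linarith
  have hG : Complex.Gamma (1 - m) ≠ 0 := Complex.Gamma_ne_zero_of_re_pos (by simp; linarith)
  have h2 : (2 : ℂ) ^ m ≠ 0 := by simp [Complex.cpow_eq_zero_iff]
  have hpi : (Real.pi : ℂ) ≠ 0 := by exact_mod_cast Real.pi_ne_zero
  rw [integral_sin_cpow_eq_Gamma (by simp; linarith), Complex.Gamma_add_one _ h1,
    Complex.cpow_sub _ _ two_ne_zero, poissonConst, show (1 - m + 1) / 2 = 1 - m / 2 by ring]
  simp only [Complex.cpow_one]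
  field_simp

/-- This is the normalization behind the boundary values. The integral is `2^(-m) Γ((1 - m)/2)² /
Γ(1 - m)`, and Legendre's duplication formula at `(1 - m)/2` makes it the reciprocal of `C_m`. -/
theorem poissonConst_mul_integral {m : ℂ} (hm : m.re < 1) :
    poissonConst m * ∫ s : ℝ, ((1 + s ^ 2 : ℝ) : ℂ) ^ (-(1 - m / 2)) = 1 := by
  have hG : Complex.Gamma (1 - m) ≠ 0 := Complex.Gamma_ne_zero_of_re_pos (by simp; linarith)
  have h2 : (2 : ℂ) ^ m ≠ 0 := by simp [Complex.cpow_eq_zero_iff]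
  have hpi : (Real.pi : ℂ) ≠ 0 := by exact_mod_cast Real.pi_ne_zero
  have hdup := Complex.Gamma_mul_Gamma_add_half ((1 - m) / 2)
  rw [mul_div_cancel₀ _ two_ne_zero, show (1 : ℂ) - (1 - m) = m by ring,
    show (1 - m) / 2 + 1 / 2 = 1 - m / 2 by ring] at hdup
  have hsq : ((√Real.pi : ℝ) : ℂ) ^ 2 = Real.pi := by
    exact_mod_cast Real.sq_sqrt Real.pi_pos.le
  rw [integral_one_add_sq_cpow, integral_sin_cpow_eq_Gamma (by simp; linarith), poissonConst,
    show 2 * (1 - m / 2) - 2 = -m by ring, show -m + 1 = 1 - m by ring, Complex.cpow_neg]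
  rw [show 1 - m / 2 = (2 - m) / 2 by ring] at hdup ⊢
  field_simp
  rw [← mul_pow, mul_comm (Complex.Gamma ((2 - m) / 2)), hdup, mul_pow, hsq]
  ring

/-! ### Moment kernels and differentiation under the integral -/

/-- The kernel `(y - η)^j (x² + (y - η)²)^(-s)`. -/
def momentKernel (s : ℂ) (j : ℕ) (p : ℝ × ℝ) (η : ℝ) : ℂ :=
  ((p.2 - η : ℝ) : ℂ) ^ j * ((p.1 ^ 2 + (p.2 - η) ^ 2 : ℝ) : ℂ) ^ (-s)

/-- The integral of a density against `momentKernel`. -/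
def momentIntegral (u : ℝ → ℝ) (s : ℂ) (j : ℕ) (p : ℝ × ℝ) : ℂ :=
  ∫ η : ℝ, (u η : ℂ) * momentKernel s j p η

/-- The real-linear functional `a dx + b dy` on `ℝ × ℝ`. -/
def complexCovector (a b : ℂ) : ℝ × ℝ →L[ℝ] ℂ :=
  (ContinuousLinearMap.fst ℝ ℝ ℝ).smulRight a + (ContinuousLinearMap.snd ℝ ℝ ℝ).smulRight b

theorem complexCovector_apply (a b : ℂ) (v : ℝ × ℝ) :
    complexCovector a b v = v.1 * a + v.2 * b := by
  simp [complexCovector]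

theorem norm_complexCovector_le (a b : ℂ) : ‖complexCovector a b‖ ≤ ‖a‖ + ‖b‖ := by
  refine ContinuousLinearMap.opNorm_le_bound _ (by positivity) fun v => ?_
  rw [complexCovector_apply]
  refine (norm_add_le _ _).trans ?_
  rw [norm_mul, norm_mul, Complex.norm_real, Complex.norm_real]
  nlinarith [norm_fst_le v, norm_snd_le v, norm_nonneg a, norm_nonneg b]

/-- `complexCovector` as a continuous linear map of its coefficients. -/
def complexCovectorCLM : ℂ × ℂ →L[ℝ] (ℝ × ℝ →L[ℝ] ℂ) :=
  LinearMap.mkContinuous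
    { toFun := fun c => complexCovector c.1 c.2
      map_add' := fun c d => by
        ext <;> simp [complexCovector_apply, mul_add]
      map_smul' := fun r c => by
        ext <;> simp [complexCovector_apply] } 2 fun c => by
    refine (norm_complexCovector_le _ _).trans ?_
    linarith [norm_fst_le c, norm_snd_le c]

theorem complexCovectorCLM_apply (c : ℂ × ℂ) :
    complexCovectorCLM c = complexCovector c.1 c.2 := rfl

theorem isOpen_rightHalfPlane : IsOpen rightHalfPlane :=
  isOpen_lt continuous_const continuous_fst

theorem sq_add_sq_pos {p : ℝ × ℝ} (hp : 0 < p.1) (η : ℝ) : 0 < p.1 ^ 2 + (p.2 - η) ^ 2 := by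
  positivity

/-- The family of kernels is closed under differentiation, up to coefficients in `x`. For `j = 0`
the truncated index `j - 1` is harmless, as its coefficient vanishes. -/
theorem hasFDerivAt_momentKernel (s : ℂ) (j : ℕ) {p : ℝ × ℝ} (hp : 0 < p.1) (η : ℝ) :
    HasFDerivAt (fun q => momentKernel s j q η)
      (complexCovector (-2 * s * p.1 * momentKernel (s + 1) j p η)
        (j * momentKernel s (j - 1) p η - 2 * s * momentKernel (s + 1) (j + 1) p η)) p := by
  have hpos := sq_add_sq_pos hp η
  have h1 : HasFDerivAt (fun q : ℝ × ℝ => q.2 - η) (ContinuousLinearMap.snd ℝ ℝ ℝ) p :=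
    hasFDerivAt_snd.sub_const η
  have h2 : HasFDerivAt (fun q : ℝ × ℝ => q.1 ^ 2 + (q.2 - η) ^ 2)
      ((2 * p.1) • ContinuousLinearMap.fst ℝ ℝ ℝ +
        (2 * (p.2 - η)) • ContinuousLinearMap.snd ℝ ℝ ℝ) p := by
    refine (((hasFDerivAt_fst (𝕜 := ℝ) (p := p)).pow 2).add (h1.pow 2)).congr_fderiv ?_
    simp
  have hc1 : HasDerivAt (fun t : ℝ => (t : ℂ) ^ j) (j * ((p.2 - η : ℝ) : ℂ) ^ (j - 1))
      (p.2 - η) := by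
    simpa using (hasDerivAt_pow j ((p.2 - η : ℝ) : ℂ)).comp_ofReal
  have hc2 : HasDerivAt (fun t : ℝ => (t : ℂ) ^ (-s))
      (-s * ((p.1 ^ 2 + (p.2 - η) ^ 2 : ℝ) : ℂ) ^ (-s - 1)) (p.1 ^ 2 + (p.2 - η) ^ 2) := by
    have := (hasDerivAt_id ((p.1 ^ 2 + (p.2 - η) ^ 2 : ℝ) : ℂ)).cpow_const (c := -s)
      (Complex.ofReal_mem_slitPlane.2 hpos)
    simpa using this.comp_ofReal
  have := (hc1.hasFDerivAt.comp p h1).mul (HasFDerivAt.comp (f := fun q : ℝ × ℝ =>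
    q.1 ^ 2 + (q.2 - η) ^ 2) p hc2.hasFDerivAt h2)
  refine this.congr_fderiv ?_
  ext
  · simp [complexCovector_apply, momentKernel]
    ring_nf
  · simp [complexCovector_apply, momentKernel]
    ring_nf

theorem norm_momentKernel_le (s : ℂ) (j : ℕ) {p : ℝ × ℝ} (hp : 0 < p.1) (η : ℝ) :
    ‖momentKernel s j p η‖ ≤ (p.1 ^ 2 + (p.2 - η) ^ 2) ^ ((j : ℝ) / 2 - s.re) := by
  have hpos := sq_add_sq_pos hp η
  rw [momentKernel, norm_mul, norm_pow, Complex.norm_real,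
    Complex.norm_cpow_eq_rpow_re_of_pos hpos, sub_eq_add_neg ((j : ℝ) / 2),
    Real.rpow_add hpos, Complex.neg_re]
  gcongr
  rw [div_eq_inv_mul, Real.rpow_mul hpos.le, Real.rpow_natCast, ← one_div, ← Real.sqrt_eq_rpow]
  gcongr
  exact Real.abs_le_sqrt (by nlinarith)

theorem exists_nhds_le_sq_add_sq {p₀ : ℝ × ℝ} (hp : 0 < p₀.1) :
    ∃ c > 0, ∀ᶠ p in 𝓝 p₀, 0 < p.1 ∧ p.1 < 2 * p₀.1 ∧
      ∀ η : ℝ, c * (1 + η ^ 2) ≤ p.1 ^ 2 + (p.2 - η) ^ 2 := by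
  set Y := |p₀.2| + 1 with hY
  -- From `1 + η² ≤ (1 + 2Y²) + 2 (y - η)²`: the first term of the minimum lets `x² ≥ x₀² / 4`
  -- absorb `c (1 + 2Y²)`, the second gives `2c ≤ 1`.
  refine ⟨min (p₀.1 ^ 2 / 4 / (1 + 2 * Y ^ 2)) (1 / 2), by positivity, ?_⟩
  have h1 : ∀ᶠ p : ℝ × ℝ in 𝓝 p₀, p₀.1 / 2 < p.1 :=
    continuous_fst.continuousAt.eventually (lt_mem_nhds (by linarith))
  have h2 : ∀ᶠ p : ℝ × ℝ in 𝓝 p₀, p.1 < 2 * p₀.1 :=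
    continuous_fst.continuousAt.eventually (gt_mem_nhds (by linarith))
  have h3 : ∀ᶠ p : ℝ × ℝ in 𝓝 p₀, |p.2| < Y :=
    (continuous_abs.comp continuous_snd).continuousAt.eventually
      (gt_mem_nhds (by simp [hY]))
  filter_upwards [h1, h2, h3] with p h1 h2 h3
  refine ⟨by linarith, h2, fun η => ?_⟩
  set c := min (p₀.1 ^ 2 / 4 / (1 + 2 * Y ^ 2)) (1 / 2)
  have hc0 : 0 < c := by positivity
  have hc1 : c * (1 + 2 * Y ^ 2) ≤ p₀.1 ^ 2 / 4 :=
    (le_div_iff₀ (by positivity)).1 (min_le_left _ _)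
  have hc2 : c ≤ 1 / 2 := min_le_right _ _
  have hy : p.2 ^ 2 ≤ Y ^ 2 := sq_le_sq' (by linarith [abs_lt.1 h3]) (by linarith [abs_lt.1 h3])
  have hη : 1 + η ^ 2 ≤ (1 + 2 * Y ^ 2) + 2 * (p.2 - η) ^ 2 := by
    nlinarith [sq_nonneg (2 * p.2 - η)]
  nlinarith [sq_nonneg (p.2 - η), mul_le_mul_of_nonneg_left hη hc0.le]

theorem integrable_one_add_sq_rpow {e : ℝ} (he : e < -1 / 2) :
    Integrable fun η : ℝ => (1 + η ^ 2) ^ e := by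
  have := integrable_rpow_neg_one_add_norm_sq (E := ℝ) (μ := volume) (r := -2 * e)
    (by simp; linarith)
  refine this.congr (Eventually.of_forall fun η => ?_)
  simp only [Real.norm_eq_abs, sq_abs]
  congr 1
  ring

/-- The kernel is bounded by a power of order `|η|^(j - 2 Re s)` at infinity, integrable precisely
when `2 Re s - j > 1`. The exponent being negative, a lower bound for the base valid near `p₀` gives
one majorant for all nearby points. -/
theorem exists_integrable_bound_momentKernel {s : ℂ} {j : ℕ} (hs : ((j : ℝ) + 1) / 2 < s.re)
    {p₀ : ℝ × ℝ} (hp : 0 < p₀.1) :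
    ∃ g : ℝ → ℝ, Integrable g ∧ ∀ᶠ p in 𝓝 p₀, ∀ η, ‖momentKernel s j p η‖ ≤ g η := by
  obtain ⟨c, hc, h⟩ := exists_nhds_le_sq_add_sq hp
  refine ⟨fun η => c ^ ((j : ℝ) / 2 - s.re) * (1 + η ^ 2) ^ ((j : ℝ) / 2 - s.re),
    (integrable_one_add_sq_rpow (by linarith)).const_mul _, ?_⟩
  filter_upwards [h] with p ⟨hp, _, hle⟩ η
  refine (norm_momentKernel_le s j hp η).trans ?_
  rw [← Real.mul_rpow hc.le (by positivity)]
  exact Real.rpow_le_rpow_of_nonpos (by positivity) (hle η) (by linarith)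

theorem continuous_momentKernel (s : ℂ) (j : ℕ) {p : ℝ × ℝ} (hp : 0 < p.1) :
    Continuous (momentKernel s j p) := by
  refine Continuous.mul (by fun_prop) (Continuous.cpow (by fun_prop) continuous_const fun η => ?_)
  exact Complex.ofReal_mem_slitPlane.2 (sq_add_sq_pos hp η)

section

variable {u : ℝ → ℝ} {M : ℝ}

theorem integrable_mul_momentKernel (hu : Continuous u) (hb : ∀ y, |u y| ≤ M) {s : ℂ} {j : ℕ}
    (hs : ((j : ℝ) + 1) / 2 < s.re) {p : ℝ × ℝ} (hp : 0 < p.1) :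
    Integrable fun η => (u η : ℂ) * momentKernel s j p η := by
  obtain ⟨g, hg, h⟩ := exists_integrable_bound_momentKernel hs hp
  have : Integrable (momentKernel s j p) :=
    hg.mono' (continuous_momentKernel s j hp).aestronglyMeasurable
      (Eventually.of_forall h.self_of_nhds)
  exact this.bdd_mul (c := M) (by fun_prop) (Eventually.of_forall fun η => by simpa using hb η)

/-- The gap `2 Re s - j` does not decrease for any of the three kernels in the derivative, so each
meets the same integrability condition and domination applies. -/
theorem hasFDerivAt_momentIntegral (hu : Continuous u) (hb : ∀ y, |u y| ≤ M) {s : ℂ} {j : ℕ}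
    (hs : ((j : ℝ) + 1) / 2 < s.re) {p : ℝ × ℝ} (hp : 0 < p.1) :
    HasFDerivAt (momentIntegral u s j)
      (complexCovector (-2 * s * p.1 * momentIntegral u (s + 1) j p)
        (j * momentIntegral u s (j - 1) p - 2 * s * momentIntegral u (s + 1) (j + 1) p)) p := by
  have hs1 : ((j : ℝ) + 1) / 2 < (s + 1).re := by simp; linarith
  have hs2 : (((j - 1 : ℕ) : ℝ) + 1) / 2 < s.re := by
    have : ((j - 1 : ℕ) : ℝ) ≤ j := by exact_mod_cast Nat.sub_le j 1
    linarith
  have hs3 : (((j + 1 : ℕ) : ℝ) + 1) / 2 < (s + 1).re := by push_cast; simp; linarith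
  obtain ⟨g1, hg1, h1⟩ := exists_integrable_bound_momentKernel hs1 hp
  obtain ⟨g2, hg2, h2⟩ := exists_integrable_bound_momentKernel hs2 hp
  obtain ⟨g3, hg3, h3⟩ := exists_integrable_bound_momentKernel hs3 hp
  obtain ⟨c, -, h0⟩ := exists_nhds_le_sq_add_sq hp
  have hM : 0 ≤ M := (abs_nonneg _).trans (hb 0)
  have i1 := integrable_mul_momentKernel hu hb hs1 hp
  have i2 := integrable_mul_momentKernel hu hb hs2 hp
  have i3 := integrable_mul_momentKernel hu hb hs3 hp
  have hmeas : ∀ᶠ q in 𝓝 p, AEStronglyMeasurable (fun η => (u η : ℂ) * momentKernel s j q η) := by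
    filter_upwards [isOpen_rightHalfPlane.mem_nhds hp] with q hq
    exact (integrable_mul_momentKernel hu hb hs hq).aestronglyMeasurable
  have i4 : Integrable fun η => j * ((u η : ℂ) * momentKernel s (j - 1) p η)
      - 2 * s * ((u η : ℂ) * momentKernel (s + 1) (j + 1) p η) :=
    (i2.const_mul _).sub (i3.const_mul _)
  have hpair : Integrable fun η => ((-2 * s * p.1 * ((u η : ℂ) * momentKernel (s + 1) j p η),
      j * ((u η : ℂ) * momentKernel s (j - 1) p η)
        - 2 * s * ((u η : ℂ) * momentKernel (s + 1) (j + 1) p η)) : ℂ × ℂ) :=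
    (i1.const_mul _).prodMk i4
  have hmeas' : AEStronglyMeasurable fun η => complexCovector
      (-2 * s * p.1 * ((u η : ℂ) * momentKernel (s + 1) j p η))
      (j * ((u η : ℂ) * momentKernel s (j - 1) p η)
        - 2 * s * ((u η : ℂ) * momentKernel (s + 1) (j + 1) p η)) := by
    have h := complexCovectorCLM.continuous.comp_aestronglyMeasurable hpair.aestronglyMeasurable
    simpa only [complexCovectorCLM_apply] using h
  have hbd : ∀ η, ∀ q ∈ {q : ℝ × ℝ | (0 < q.1 ∧ q.1 < 2 * p.1 ∧
        ∀ η : ℝ, c * (1 + η ^ 2) ≤ q.1 ^ 2 + (q.2 - η) ^ 2) ∧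
      (∀ η, ‖momentKernel (s + 1) j q η‖ ≤ g1 η) ∧
      (∀ η, ‖momentKernel s (j - 1) q η‖ ≤ g2 η) ∧
      (∀ η, ‖momentKernel (s + 1) (j + 1) q η‖ ≤ g3 η)},
      ‖complexCovector (-2 * s * q.1 * ((u η : ℂ) * momentKernel (s + 1) j q η))
        (j * ((u η : ℂ) * momentKernel s (j - 1) q η)
        - 2 * s * ((u η : ℂ) * momentKernel (s + 1) (j + 1) q η))‖ ≤
      2 * ‖s‖ * (2 * p.1) * (M * g1 η) + (j * (M * g2 η) + 2 * ‖s‖ * (M * g3 η)) := by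
    rintro η q ⟨⟨hq0, hq1, -⟩, hk1, hk2, hk3⟩
    have hu' : ‖(u η : ℂ)‖ ≤ M := by simpa using hb η
    refine (norm_complexCovector_le _ _).trans (add_le_add ?_ ((norm_sub_le _ _).trans
      (add_le_add ?_ ?_)))
    · simp only [norm_mul, norm_neg, Complex.norm_real, Complex.norm_ofNat, Real.norm_eq_abs,
        abs_of_pos hq0] at hu' ⊢
      gcongr
      exact hk1 η
    · simp only [norm_mul, Complex.norm_natCast]
      gcongr
      exact hk2 η
    · simp only [norm_mul, Complex.norm_ofNat]
      gcongr
      exact hk3 η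
  have hbint : Integrable fun η =>
      2 * ‖s‖ * (2 * p.1) * (M * g1 η) + (j * (M * g2 η) + 2 * ‖s‖ * (M * g3 η)) :=
    ((hg1.const_mul M).const_mul _).add (((hg2.const_mul M).const_mul _).add
      ((hg3.const_mul M).const_mul _))
  have hdiff : ∀ η, ∀ q : ℝ × ℝ, 0 < q.1 →
      HasFDerivAt (fun q => (u η : ℂ) * momentKernel s j q η)
        (complexCovector (-2 * s * q.1 * ((u η : ℂ) * momentKernel (s + 1) j q η))
        (j * ((u η : ℂ) * momentKernel s (j - 1) q η)
        - 2 * s * ((u η : ℂ) * momentKernel (s + 1) (j + 1) q η))) q := by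
    intro η q hq
    refine ((hasFDerivAt_momentKernel s j hq η).const_mul (u η : ℂ)).congr_fderiv ?_
    ext <;> simp [complexCovector_apply] <;> ring
  have key := hasFDerivAt_integral_of_dominated_of_fderiv_le (𝕜 := ℝ) (μ := volume)
    (h0.and (h1.and (h2.and h3))) hmeas (integrable_mul_momentKernel hu hb hs hp) hmeas'
    (Eventually.of_forall hbd) hbint (Eventually.of_forall fun η q hq => hdiff η q hq.1.1)
  refine key.congr_fderiv ?_
  -- The integral of the covector-valued derivative is the covector of the integrals, by linearity
  -- and continuity in the pair of coefficients.
  have := complexCovectorCLM.integral_comp_comm hpair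
  simp only [complexCovectorCLM_apply] at this
  rw [this, integral_pair (i1.const_mul _) i4, integral_sub (i2.const_mul _) (i3.const_mul _),
    integral_const_mul, integral_const_mul, integral_const_mul]
  simp only [momentIntegral]

theorem contDiffOn_momentIntegral (hu : Continuous u) (hb : ∀ y, |u y| ≤ M) (n : ℕ) :
    ∀ {s : ℂ} {j : ℕ}, ((j : ℝ) + 1) / 2 < s.re →
      ContDiffOn ℝ n (momentIntegral u s j) rightHalfPlane := by
  induction n with
  | zero =>
    intro s j hs
    rw [Nat.cast_zero, contDiffOn_zero]
    exact fun p hp => (hasFDerivAt_momentIntegral hu hb hs hp).continuousAt.continuousWithinAt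
  | succ n ih =>
    intro s j hs
    have hs1 : ((j : ℝ) + 1) / 2 < (s + 1).re := by simp; linarith
    have hs2 : (((j - 1 : ℕ) : ℝ) + 1) / 2 < s.re := by
      have : ((j - 1 : ℕ) : ℝ) ≤ j := by exact_mod_cast Nat.sub_le j 1
      linarith
    have hs3 : (((j + 1 : ℕ) : ℝ) + 1) / 2 < (s + 1).re := by push_cast; simp; linarith
    rw [Nat.cast_add, Nat.cast_one, contDiffOn_succ_iff_hasFDerivWithinAt_of_uniqueDiffOn
      isOpen_rightHalfPlane.uniqueDiffOn]
    refine ⟨by simp, _, ?_, fun p hp =>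
      (hasFDerivAt_momentIntegral hu hb hs hp).hasFDerivWithinAt⟩
    have hx : ContDiffOn ℝ n (fun p : ℝ × ℝ => (p.1 : ℂ)) rightHalfPlane :=
      (Complex.ofRealCLM.contDiff.comp contDiff_fst).contDiffOn
    exact complexCovectorCLM.contDiff.comp_contDiffOn
      (((contDiffOn_const.mul hx).mul (ih hs1)).prodMk
        ((contDiffOn_const.mul (ih hs2)).sub (contDiffOn_const.mul (ih hs3))))

end

/-! ### The Weinstein equation for the Poisson integral -/

section

variable {u : ℝ → ℝ} {M : ℝ}

theorem hasDerivAt_momentIntegral_fst (hu : Continuous u) (hb : ∀ y, |u y| ≤ M) {s : ℂ} {j : ℕ}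
    (hs : ((j : ℝ) + 1) / 2 < s.re) {p : ℝ × ℝ} (hp : 0 < p.1) :
    HasDerivAt (fun t => momentIntegral u s j (t, p.2))
      (-2 * s * p.1 * momentIntegral u (s + 1) j p) p.1 := by
  have h1 : HasDerivAt (fun t : ℝ => (t, p.2)) ((1 : ℝ), (0 : ℝ)) p.1 :=
    (hasDerivAt_id _).prodMk (hasDerivAt_const _ _)
  have := (hasFDerivAt_momentIntegral hu hb hs hp).comp_hasDerivAt p.1 h1
  simpa [complexCovector_apply, Function.comp_def] using this

theorem hasDerivAt_momentIntegral_snd (hu : Continuous u) (hb : ∀ y, |u y| ≤ M) {s : ℂ} {j : ℕ}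
    (hs : ((j : ℝ) + 1) / 2 < s.re) {p : ℝ × ℝ} (hp : 0 < p.1) :
    HasDerivAt (fun t => momentIntegral u s j (p.1, t))
      (j * momentIntegral u s (j - 1) p - 2 * s * momentIntegral u (s + 1) (j + 1) p) p.2 := by
  have h1 : HasDerivAt (fun t : ℝ => (p.1, t)) ((0 : ℝ), (1 : ℝ)) p.2 :=
    (hasDerivAt_const _ _).prodMk (hasDerivAt_id _)
  have := (hasFDerivAt_momentIntegral hu hb hs hp).comp_hasDerivAt p.2 h1
  simpa [complexCovector_apply, Function.comp_def] using this

/-- Write `(y - η)² = (x² + (y - η)²) - x²`. This eliminates the second moment produced by `∂ᵧᵧ`. -/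
theorem momentIntegral_add_two (hu : Continuous u) (hb : ∀ y, |u y| ≤ M) {s : ℂ} {j : ℕ}
    (hs : ((j : ℝ) + 1) / 2 < s.re) {p : ℝ × ℝ} (hp : 0 < p.1) :
    momentIntegral u (s + 1) (j + 2) p =
      momentIntegral u s j p - p.1 ^ 2 * momentIntegral u (s + 1) j p := by
  have hs1 : ((j : ℝ) + 1) / 2 < (s + 1).re := by simp; linarith
  rw [momentIntegral, momentIntegral, momentIntegral, ← integral_const_mul,
    ← integral_sub (integrable_mul_momentKernel hu hb hs hp)
      ((integrable_mul_momentKernel hu hb hs1 hp).const_mul _)]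
  congr 1 with η
  have hne : ((p.1 ^ 2 + (p.2 - η) ^ 2 : ℝ) : ℂ) ≠ 0 := by
    exact_mod_cast (sq_add_sq_pos hp η).ne'
  have e : ((p.1 ^ 2 + (p.2 - η) ^ 2 : ℝ) : ℂ) ^ (-s) =
      ((p.1 ^ 2 + (p.2 - η) ^ 2 : ℝ) : ℂ) ^ (-(s + 1)) *
        ((p.1 : ℂ) ^ 2 + ((p.2 - η : ℝ) : ℂ) ^ 2) := by
    rw [neg_add, ← sub_eq_add_neg, Complex.cpow_sub _ _ hne, Complex.cpow_one]
    rw [show (p.1 : ℂ) ^ 2 + ((p.2 - η : ℝ) : ℂ) ^ 2 = ((p.1 ^ 2 + (p.2 - η) ^ 2 : ℝ) : ℂ) by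
      push_cast; rfl, div_mul_cancel₀ _ hne]
  simp only [momentKernel]
  rw [e]
  ring

theorem poissonIntegrand_eq (m : ℂ) (u : ℝ → ℝ) (p : ℝ × ℝ) (η : ℝ) :
    poissonIntegrand m u p η = (u η : ℂ) * momentKernel (1 - m / 2) 0 p η := by
  rw [poissonIntegrand, momentKernel, Complex.cpow_neg, pow_zero, one_mul, div_eq_mul_inv]

theorem poissonIntegral_eq (m : ℂ) (u : ℝ → ℝ) (p : ℝ × ℝ) :
    poissonIntegral m u p =
      poissonConst m * (p.1 : ℂ) ^ (1 - m) * momentIntegral u (1 - m / 2) 0 p := by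
  simp only [poissonIntegral, momentIntegral, poissonIntegrand_eq]

theorem re_one_sub_half (m : ℂ) : (1 - m / 2).re = 1 - m.re / 2 := by
  rw [show m / 2 = m / ((2 : ℝ) : ℂ) by push_cast; rfl, Complex.sub_re, Complex.div_ofReal_re]
  rfl

theorem integrable_poissonIntegrand {m : ℂ} (hm : m.re < 1) (hu : Continuous u)
    (hb : ∀ y, |u y| ≤ M) {p : ℝ × ℝ} (hp : 0 < p.1) : Integrable (poissonIntegrand m u p) := by
  simp only [funext (poissonIntegrand_eq m u p)]
  exact integrable_mul_momentKernel hu hb (by rw [re_one_sub_half]; norm_num; linarith) hp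

theorem hasDerivAt_ofReal_cpow_const_of_pos {x : ℝ} (hx : 0 < x) (c : ℂ) :
    HasDerivAt (fun t : ℝ => (t : ℂ) ^ c) (c * (x : ℂ) ^ (c - 1)) x := by
  have := (hasDerivAt_id (x : ℂ)).cpow_const (c := c) (Complex.ofReal_mem_slitPlane.2 hx)
  simpa using this.comp_ofReal

theorem contDiffOn_ofReal_fst_cpow (c : ℂ) {n : WithTop ℕ∞} :
    ContDiffOn ℝ n (fun p : ℝ × ℝ => (p.1 : ℂ) ^ c) rightHalfPlane := by
  have : ContDiffOn ℝ n (fun p : ℝ × ℝ => (p.1 : ℂ)) rightHalfPlane :=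
    (Complex.ofRealCLM.contDiff.comp contDiff_fst).contDiffOn
  have hexp : ContDiffOn ℝ n (fun p : ℝ × ℝ => Complex.exp ((Real.log p.1 : ℂ) * c))
      rightHalfPlane := by
    refine ContDiffOn.cexp (ContDiffOn.mul ?_ contDiffOn_const)
    exact Complex.ofRealCLM.contDiff.comp_contDiffOn
      (contDiff_fst.contDiffOn.log fun p hp => (ne_of_gt hp : p.1 ≠ 0))
  refine hexp.congr fun p hp => ?_
  have hp' : 0 < p.1 := hp
  rw [Complex.cpow_def_of_ne_zero (by exact_mod_cast hp'.ne'), Complex.ofReal_log hp'.le]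

theorem partialX_poissonIntegral {m : ℂ} (hm : m.re < 1) (hu : Continuous u)
    (hb : ∀ y, |u y| ≤ M) {p : ℝ × ℝ} (hp : 0 < p.1) :
    partialX (poissonIntegral m u) p = poissonConst m * (p.1 : ℂ) ^ (-m) *
      ((1 - m) * momentIntegral u (1 - m / 2) 0 p -
        (2 - m) * p.1 ^ 2 * momentIntegral u (1 - m / 2 + 1) 0 p) := by
  have hs : (((0 : ℕ) : ℝ) + 1) / 2 < (1 - m / 2).re := by
    rw [re_one_sub_half]; norm_num; linarith
  have h := ((hasDerivAt_ofReal_cpow_const_of_pos hp (1 - m)).const_mul (poissonConst m)).mul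
    (hasDerivAt_momentIntegral_fst hu hb hs hp)
  have hx : (p.1 : ℂ) ≠ 0 := by exact_mod_cast hp.ne'
  have e : (p.1 : ℂ) ^ (1 - m) = (p.1 : ℂ) ^ (-m) * p.1 := by
    rw [show 1 - m = -m + 1 by ring, Complex.cpow_add _ _ hx, Complex.cpow_one]
  rw [partialX]
  simp only [poissonIntegral_eq]
  refine h.deriv.trans ?_
  rw [show 1 - m - 1 = -m by ring, e]
  ring

theorem partialX_partialX_poissonIntegral {m : ℂ} (hm : m.re < 1) (hu : Continuous u)
    (hb : ∀ y, |u y| ≤ M) {p : ℝ × ℝ} (hp : 0 < p.1) :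
    partialX (partialX (poissonIntegral m u)) p = poissonConst m * (p.1 : ℂ) ^ (-m) *
      (-m / p.1 * ((1 - m) * momentIntegral u (1 - m / 2) 0 p -
          (2 - m) * p.1 ^ 2 * momentIntegral u (1 - m / 2 + 1) 0 p) -
        (1 - m) * (2 - m) * p.1 * momentIntegral u (1 - m / 2 + 1) 0 p -
        2 * (2 - m) * p.1 * momentIntegral u (1 - m / 2 + 1) 0 p +
        (2 - m) * (4 - m) * p.1 ^ 3 * momentIntegral u (1 - m / 2 + 1 + 1) 0 p) := by
  have hs : (((0 : ℕ) : ℝ) + 1) / 2 < (1 - m / 2).re := by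
    rw [re_one_sub_half]; norm_num; linarith
  have hs1 : (((0 : ℕ) : ℝ) + 1) / 2 < (1 - m / 2 + 1).re := by
    rw [Complex.add_re, re_one_sub_half]; norm_num; linarith
  have hx : (p.1 : ℂ) ≠ 0 := by exact_mod_cast hp.ne'
  have hsq : HasDerivAt (fun t : ℝ => (t : ℂ) ^ 2) (2 * (p.1 : ℂ)) p.1 := by
    simpa using (hasDerivAt_pow 2 (p.1 : ℂ)).comp_ofReal
  have h := ((hasDerivAt_ofReal_cpow_const_of_pos hp (-m)).const_mul (poissonConst m)).mul
    (((hasDerivAt_momentIntegral_fst hu hb hs hp).const_mul (1 - m)).sub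
      ((hsq.const_mul (2 - m)).mul (hasDerivAt_momentIntegral_fst hu hb hs1 hp)))
  rw [partialX]
  have hev : (fun t : ℝ => partialX (poissonIntegral m u) (t, p.2)) =ᶠ[𝓝 p.1] fun t : ℝ =>
      poissonConst m * (t : ℂ) ^ (-m) * ((1 - m) * momentIntegral u (1 - m / 2) 0 (t, p.2) -
        (2 - m) * t ^ 2 * momentIntegral u (1 - m / 2 + 1) 0 (t, p.2)) := by
    filter_upwards [lt_mem_nhds hp] with t ht
    exact partialX_poissonIntegral hm hu hb (p := (t, p.2)) ht
  rw [hev.deriv_eq]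
  refine h.deriv.trans ?_
  simp only [Pi.sub_apply, Pi.mul_apply]
  rw [Complex.cpow_sub _ _ hx, Complex.cpow_one]
  field_simp
  ring

theorem partialY_poissonIntegral {m : ℂ} (hm : m.re < 1) (hu : Continuous u)
    (hb : ∀ y, |u y| ≤ M) {p : ℝ × ℝ} (hp : 0 < p.1) :
    partialY (poissonIntegral m u) p = poissonConst m * (p.1 : ℂ) ^ (1 - m) *
      (-(2 - m) * momentIntegral u (1 - m / 2 + 1) 1 p) := by
  have hs : (((0 : ℕ) : ℝ) + 1) / 2 < (1 - m / 2).re := by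
    rw [re_one_sub_half]; norm_num; linarith
  have h := (hasDerivAt_momentIntegral_snd hu hb hs hp).const_mul
    (poissonConst m * (p.1 : ℂ) ^ (1 - m))
  rw [partialY]
  simp only [poissonIntegral_eq]
  refine h.deriv.trans ?_
  simp only [Nat.cast_zero, zero_add]
  ring

theorem partialY_partialY_poissonIntegral {m : ℂ} (hm : m.re < 1) (hu : Continuous u)
    (hb : ∀ y, |u y| ≤ M) {p : ℝ × ℝ} (hp : 0 < p.1) :
    partialY (partialY (poissonIntegral m u)) p = poissonConst m * (p.1 : ℂ) ^ (1 - m) *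
      (-(2 - m) * (momentIntegral u (1 - m / 2 + 1) 0 p -
        (4 - m) * momentIntegral u (1 - m / 2 + 1 + 1) 2 p)) := by
  have hs1 : (((1 : ℕ) : ℝ) + 1) / 2 < (1 - m / 2 + 1).re := by
    rw [Complex.add_re, re_one_sub_half]; norm_num; linarith
  have h := (((hasDerivAt_momentIntegral_snd hu hb hs1 hp).const_mul (-(2 - m)))).const_mul
    (poissonConst m * (p.1 : ℂ) ^ (1 - m))
  rw [partialY]
  have hev : ∀ t : ℝ, partialY (poissonIntegral m u) (p.1, t) =
      poissonConst m * (p.1 : ℂ) ^ (1 - m) *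
      (-(2 - m) * momentIntegral u (1 - m / 2 + 1) 1 (p.1, t)) := fun t =>
    partialY_poissonIntegral hm hu hb (p := (p.1, t)) hp
  simp only [hev]
  refine h.deriv.trans ?_
  simp only [Nat.cast_one, Nat.sub_self, one_add_one_eq_two]
  ring

/-- Once the second moment is eliminated, all terms are multiples of the zeroth moments with
exponents `s`, `s + 1`, `s + 2`, where `s = 1 - m/2`, and their coefficients cancel. -/
theorem isAxisymmetricPotential_poissonIntegral {m : ℂ} (hm : m.re < 1) (hu : Continuous u)
    (hb : ∀ y, |u y| ≤ M) : IsAxisymmetricPotential m (poissonIntegral m u) := by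
  have hs : (((0 : ℕ) : ℝ) + 1) / 2 < (1 - m / 2).re := by
    rw [re_one_sub_half]; norm_num; linarith
  have hs1 : (((0 : ℕ) : ℝ) + 1) / 2 < (1 - m / 2 + 1).re := by
    rw [Complex.add_re, re_one_sub_half]; norm_num; linarith
  constructor
  · simp only [funext (poissonIntegral_eq m u)]
    exact (contDiffOn_const.mul (contDiffOn_ofReal_fst_cpow _)).mul
      (by exact_mod_cast contDiffOn_momentIntegral hu hb 2 hs)
  · intro p hp
    have hx : (p.1 : ℂ) ≠ 0 := by exact_mod_cast (ne_of_gt hp : p.1 ≠ 0)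
    have e : (p.1 : ℂ) ^ (1 - m) = (p.1 : ℂ) ^ (-m) * p.1 := by
      rw [show 1 - m = -m + 1 by ring, Complex.cpow_add _ _ hx, Complex.cpow_one]
    rw [weinsteinOp, partialX_partialX_poissonIntegral hm hu hb hp,
      partialY_partialY_poissonIntegral hm hu hb hp, partialX_poissonIntegral hm hu hb hp,
      momentIntegral_add_two hu hb hs1 hp, e]
    field_simp
    ring

end

/-! ### Boundary values by rescaling -/

theorem integral_comp_sub_mul {E : Type*} [NormedAddCommGroup E] [NormedSpace ℝ E]
    (f : ℝ → E) {x : ℝ} (hx : 0 < x) (y : ℝ) :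
    ∫ η, f η = x • ∫ s, f (y - x * s) := by
  rw [Measure.integral_comp_mul_left (fun t => f (y - t)) x, abs_of_pos (by positivity),
    smul_smul, mul_inv_cancel₀ hx.ne', one_smul, integral_sub_left_eq_self]

/-- With `η = y - x s` the kernel contributes `x^(m - 2)` and the measure `x`, which together cancel
`x^(1 - m)`. Only the argument of `u` still depends on the point. -/
theorem poissonIntegral_eq_scaled {m : ℂ} (u : ℝ → ℝ) {p : ℝ × ℝ} (hp : 0 < p.1) :
    poissonIntegral m u p = poissonConst m *
      ∫ s : ℝ, (u (p.2 - p.1 * s) : ℂ) * ((1 + s ^ 2 : ℝ) : ℂ) ^ (-(1 - m / 2)) := by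
  have hx : (p.1 : ℂ) ≠ 0 := by exact_mod_cast hp.ne'
  have key : ∀ s : ℝ, poissonIntegrand m u p (p.2 - p.1 * s) = (p.1 : ℂ) ^ (m - 2) *
      ((u (p.2 - p.1 * s) : ℂ) * ((1 + s ^ 2 : ℝ) : ℂ) ^ (-(1 - m / 2))) := fun s => by
    rw [poissonIntegrand_eq, momentKernel, pow_zero, one_mul,
      show p.1 ^ 2 + (p.2 - (p.2 - p.1 * s)) ^ 2 = p.1 ^ 2 * (1 + s ^ 2) by ring,
      Complex.ofReal_mul, Complex.mul_cpow_ofReal_nonneg (by positivity) (by positivity),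
      Complex.ofReal_sq_cpow hp, show 2 * -(1 - m / 2) = m - 2 by ring]
    ring
  rw [poissonIntegral, integral_comp_sub_mul _ hp p.2]
  simp only [key]
  rw [integral_const_mul, Complex.real_smul]
  have e : (p.1 : ℂ) ^ (1 - m) * p.1 * (p.1 : ℂ) ^ (m - 2) = 1 := by
    nth_rewrite 2 [← Complex.cpow_one (p.1 : ℂ)]
    rw [← Complex.cpow_add _ _ hx, ← Complex.cpow_add _ _ hx,
      show 1 - m + 1 + (m - 2) = 0 by ring, Complex.cpow_zero]
  linear_combination (poissonConst m *
      ∫ s : ℝ, (u (p.2 - p.1 * s) : ℂ) * ((1 + s ^ 2 : ℝ) : ℂ) ^ (-(1 - m / 2))) * e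

theorem norm_one_add_sq_cpow (m : ℂ) (s : ℝ) :
    ‖((1 + s ^ 2 : ℝ) : ℂ) ^ (-(1 - m / 2))‖ = (1 + s ^ 2) ^ (-(1 - m.re / 2)) := by
  rw [Complex.norm_cpow_eq_rpow_re_of_pos (by positivity), Complex.neg_re, re_one_sub_half]

theorem continuous_one_add_sq_cpow (c : ℂ) :
    Continuous fun s : ℝ => ((1 + s ^ 2 : ℝ) : ℂ) ^ c :=
  Continuous.cpow (by fun_prop) continuous_const fun s =>
    Complex.ofReal_mem_slitPlane.2 (by positivity)

section

variable {u : ℝ → ℝ} {M : ℝ}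

theorem hasBoundaryValues_poissonIntegral {m : ℂ} (hm : m.re < 1) (hu : Continuous u)
    (hb : ∀ y, |u y| ≤ M) : HasBoundaryValues (poissonIntegral m u) u := by
  intro y
  have key : Tendsto (fun p : ℝ × ℝ =>
      ∫ s : ℝ, (u (p.2 - p.1 * s) : ℂ) * ((1 + s ^ 2 : ℝ) : ℂ) ^ (-(1 - m / 2)))
      (𝓝[rightHalfPlane] ((0 : ℝ), y))
      (𝓝 (∫ s : ℝ, (u y : ℂ) * ((1 + s ^ 2 : ℝ) : ℂ) ^ (-(1 - m / 2)))) := by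
    refine tendsto_integral_filter_of_dominated_convergence
      (fun s => M * (1 + s ^ 2) ^ (-(1 - m.re / 2))) ?_ ?_ ?_ ?_
    · refine Eventually.of_forall fun p => Continuous.aestronglyMeasurable ?_
      exact Continuous.mul (by fun_prop) (continuous_one_add_sq_cpow _)
    · refine Eventually.of_forall fun p => Eventually.of_forall fun s => ?_
      rw [norm_mul, norm_one_add_sq_cpow, Complex.norm_real, Real.norm_eq_abs]
      gcongr
      exact hb _
    · exact (integrable_one_add_sq_rpow (by linarith)).const_mul M
    · refine Eventually.of_forall fun s => Tendsto.mul_const _ ?_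
      refine tendsto_nhdsWithin_of_tendsto_nhds ?_
      have : Continuous fun p : ℝ × ℝ => (u (p.2 - p.1 * s) : ℂ) := by fun_prop
      simpa using this.tendsto ((0 : ℝ), y)
  have h2 := key.const_mul (poissonConst m)
  rw [integral_const_mul, mul_left_comm, poissonConst_mul_integral hm, mul_one] at h2
  refine h2.congr' ?_
  filter_upwards [self_mem_nhdsWithin] with p hp
  exact (poissonIntegral_eq_scaled u hp).symm

/-! ### Behaviour at infinity -/

theorem integral_sq_add_sq_rpow (σ : ℝ) {p : ℝ × ℝ} (hp : 0 < p.1) :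
    p.1 ^ (2 * σ - 1) * ∫ η : ℝ, (p.1 ^ 2 + (p.2 - η) ^ 2) ^ (-σ) =
      ∫ s : ℝ, (1 + s ^ 2) ^ (-σ) := by
  have key : ∀ s : ℝ, (p.1 ^ 2 + (p.2 - (p.2 - p.1 * s)) ^ 2) ^ (-σ) =
      p.1 ^ (-(2 * σ)) * (1 + s ^ 2) ^ (-σ) := fun s => by
    rw [show p.1 ^ 2 + (p.2 - (p.2 - p.1 * s)) ^ 2 = p.1 ^ 2 * (1 + s ^ 2) by ring,
      Real.mul_rpow (by positivity) (by positivity), ← Real.rpow_natCast, ← Real.rpow_mul hp.le]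
    norm_num
  rw [integral_comp_sub_mul _ hp p.2]
  simp only [key]
  rw [integral_const_mul, smul_eq_mul, ← mul_assoc, ← mul_assoc, ← Real.rpow_add_one hp.ne',
    ← Real.rpow_add hp]
  simp

theorem integrable_sq_add_sq_rpow {σ : ℝ} (hσ : 1 / 2 < σ) {p : ℝ × ℝ} (hp : 0 < p.1) :
    Integrable fun η : ℝ => (p.1 ^ 2 + (p.2 - η) ^ 2) ^ (-σ) := by
  have h := (integrable_mul_momentKernel (u := fun _ => 1) (M := 1) continuous_const (by simp)
    (s := (σ : ℂ)) (j := 0) (by norm_num; linarith) hp).norm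
  refine h.congr (Eventually.of_forall fun η => ?_)
  simp [momentKernel]
  rw [← Complex.ofReal_sub, ← Complex.ofReal_pow, ← Complex.ofReal_pow, ← Complex.ofReal_add,
    ← Complex.ofReal_neg, Complex.norm_cpow_eq_rpow_re_of_pos (sq_add_sq_pos hp η),
    Complex.ofReal_re]

/-- The norm is the sup norm: either `|x| = ‖p‖`, or `|y| = ‖p‖ ≥ 2R` and then `|y - η| ≥ |y| / 2`.
-/
theorem sq_norm_le_sq_add_sq {p : ℝ × ℝ} {R η : ℝ} (hR : 2 * R ≤ ‖p‖) (hη : |η| ≤ R) :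
    ‖p‖ ^ 2 / 4 ≤ p.1 ^ 2 + (p.2 - η) ^ 2 := by
  have hη' := abs_le.1 hη
  rcases max_choice ‖p.1‖ ‖p.2‖ with h | h
  · rw [← Prod.norm_def] at h
    rw [h, Real.norm_eq_abs, sq_abs]
    nlinarith [sq_nonneg p.1, sq_nonneg (p.2 - η)]
  · rw [← Prod.norm_def] at h
    rw [h] at hR ⊢
    rw [Real.norm_eq_abs] at hR ⊢
    have : |p.2| / 2 ≤ |p.2 - η| := by
      have := abs_sub_abs_le_abs_sub p.2 η
      linarith
    nlinarith [sq_nonneg p.1, sq_abs (p.2 - η), abs_nonneg p.2, abs_nonneg (p.2 - η)]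

/-- Split at `|η| = R`. Outside, `|u| ≤ ε` and scaling bounds the mass of the kernel. Inside, the
denominator is at least of order `‖p‖^(2σ)` with `σ = 1 - Re m / 2`, while `x^(2σ - 1) ≤ ‖p‖^(2σ -
1)`, which leaves `1 / ‖p‖`. -/
theorem norm_poissonIntegral_le {m : ℂ} (hm : m.re < 1) (hb : ∀ y, |u y| ≤ M) {ε R : ℝ}
    (hε : 0 ≤ ε) (hR : 0 < R) (huε : ∀ η, R < |η| → |u η| ≤ ε) {p : ℝ × ℝ} (hp : 0 < p.1)
    (hpR : 2 * R ≤ ‖p‖) :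
    ‖poissonIntegral m u p‖ ≤ ‖poissonConst m‖ * (ε * ∫ s : ℝ, (1 + s ^ 2) ^ (-(1 - m.re / 2))) +
      ‖poissonConst m‖ * (4 ^ (1 - m.re / 2) * (2 * R * M)) / ‖p‖ := by
  set σ := 1 - m.re / 2 with hσ
  have hσ' : 1 / 2 < σ := by linarith
  have hM : 0 ≤ M := (abs_nonneg _).trans (hb 0)
  have hρ : 0 < ‖p‖ := by linarith
  have hint := integrable_sq_add_sq_rpow hσ' hp
  have hind : Integrable (Set.indicator (Set.Icc (-R) R)
      fun _ => M * (‖p‖ ^ 2 / 4) ^ (-σ)) :=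
    (integrable_indicator_iff measurableSet_Icc).2 (integrableOn_const (by simp))
  have hpt : ∀ η, ‖poissonIntegrand m u p η‖ ≤ ε * (p.1 ^ 2 + (p.2 - η) ^ 2) ^ (-σ) +
      Set.indicator (Set.Icc (-R) R) (fun _ => M * (‖p‖ ^ 2 / 4) ^ (-σ)) η := fun η => by
    have hpos := sq_add_sq_pos hp η
    rw [poissonIntegrand_eq, momentKernel, pow_zero, one_mul, norm_mul, Complex.norm_real,
      Real.norm_eq_abs, Complex.norm_cpow_eq_rpow_re_of_pos hpos, Complex.neg_re,
      re_one_sub_half, ← hσ]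
    by_cases h : |η| ≤ R
    · rw [Set.indicator_of_mem (show η ∈ Set.Icc (-R) R from abs_le.1 h)]
      refine le_add_of_nonneg_of_le (by positivity) ?_
      refine mul_le_mul (hb η) ?_ (by positivity) hM
      exact Real.rpow_le_rpow_of_nonpos (by positivity) (sq_norm_le_sq_add_sq hpR h)
        (by linarith)
    · rw [Set.indicator_of_notMem (fun h' : η ∈ Set.Icc (-R) R => h (abs_le.2 h')), add_zero]
      gcongr
      exact huε η (not_le.1 h)
  have hle : ‖∫ η, poissonIntegrand m u p η‖ ≤
      ε * (∫ η, (p.1 ^ 2 + (p.2 - η) ^ 2) ^ (-σ)) + 2 * R * (M * (‖p‖ ^ 2 / 4) ^ (-σ)) := by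
    refine (norm_integral_le_of_norm_le ((hint.const_mul ε).add hind)
      (Eventually.of_forall hpt)).trans_eq ?_
    rw [integral_add' (hint.const_mul ε) hind, integral_const_mul,
      integral_indicator measurableSet_Icc, setIntegral_const, smul_eq_mul, Real.volume_real_Icc,
      max_eq_left (by linarith)]
    ring
  have hp1 : p.1 ≤ ‖p‖ := (le_abs_self _).trans (norm_fst_le p)
  have hpow : p.1 ^ (2 * σ - 1) * (‖p‖ ^ 2 / 4) ^ (-σ) ≤ 4 ^ σ / ‖p‖ := by
    calc p.1 ^ (2 * σ - 1) * (‖p‖ ^ 2 / 4) ^ (-σ)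
        ≤ ‖p‖ ^ (2 * σ - 1) * (‖p‖ ^ 2 / 4) ^ (-σ) := by
          gcongr
          linarith
      _ = 4 ^ σ / ‖p‖ := by
          rw [Real.div_rpow (by positivity) (by norm_num), ← Real.rpow_natCast ‖p‖ 2,
            ← Real.rpow_mul hρ.le, Real.rpow_sub hρ, Real.rpow_one, Real.rpow_neg (by norm_num),
            show ((2 : ℕ) : ℝ) * -σ = -(2 * σ) by push_cast; ring, Real.rpow_neg hρ.le]
          field_simp
  rw [poissonIntegral, norm_mul, norm_mul, Complex.norm_cpow_eq_rpow_re_of_pos hp,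
    show (1 - m).re = 2 * σ - 1 by rw [hσ]; simp; ring, mul_assoc, mul_div_assoc, ← mul_add]
  gcongr
  calc p.1 ^ (2 * σ - 1) * ‖∫ η, poissonIntegrand m u p η‖
      ≤ p.1 ^ (2 * σ - 1) * (ε * (∫ η, (p.1 ^ 2 + (p.2 - η) ^ 2) ^ (-σ)) +
          2 * R * (M * (‖p‖ ^ 2 / 4) ^ (-σ))) := by gcongr
    _ = ε * (p.1 ^ (2 * σ - 1) * (∫ η, (p.1 ^ 2 + (p.2 - η) ^ 2) ^ (-σ))) +
          2 * R * M * (p.1 ^ (2 * σ - 1) * (‖p‖ ^ 2 / 4) ^ (-σ)) := by ring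
    _ ≤ ε * (∫ s : ℝ, (1 + s ^ 2) ^ (-σ)) + 2 * R * M * (4 ^ σ / ‖p‖) := by
        rw [integral_sq_add_sq_rpow σ hp]
        gcongr
    _ = _ := by ring

theorem vanishesAtInfinity_poissonIntegral {m : ℂ} (hm : m.re < 1)
    (hb : ∀ y, |u y| ≤ M) (h0 : Tendsto u (cocompact ℝ) (𝓝 0)) :
    VanishesAtInfinity (poissonIntegral m u) := by
  set K := ∫ s : ℝ, (1 + s ^ 2) ^ (-(1 - m.re / 2)) with hK
  have hK0 : 0 ≤ K := integral_nonneg fun s => by positivity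
  rw [VanishesAtInfinity, Metric.tendsto_nhds]
  intro ε hε
  -- Makes the far part at most `ε / 2`; the `+ 1` keeps the denominator positive.
  set δ := ε / 2 / (‖poissonConst m‖ * K + 1) with hδ
  have hden : 0 < ‖poissonConst m‖ * K + 1 := by positivity
  have hδ0 : 0 < δ := by positivity
  obtain ⟨R, hR⟩ : ∃ R : ℝ, ∀ η, R < |η| → |u η| ≤ δ := by
    have h1 := (Metric.tendsto_nhds.1 h0) δ hδ0
    rw [← Metric.cobounded_eq_cocompact, ← comap_norm_atTop, eventually_comap,
      eventually_atTop] at h1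
    obtain ⟨R, hR⟩ := h1
    exact ⟨R, fun η hη => by simpa using (hR |η| hη.le η rfl).le⟩
  have hR' : ∀ η, max R 1 < |η| → |u η| ≤ δ := fun η hη => hR η ((le_max_left _ _).trans_lt hη)
  have hnorm : Tendsto (fun p : ℝ × ℝ => ‖p‖) (cocompact (ℝ × ℝ)) atTop :=
    tendsto_norm_cocompact_atTop
  have hdiv : Tendsto (fun p : ℝ × ℝ => ‖poissonConst m‖ *
      (4 ^ (1 - m.re / 2) * (2 * max R 1 * M)) / ‖p‖) (cocompact (ℝ × ℝ)) (𝓝 0) :=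
    tendsto_const_nhds.div_atTop hnorm
  rw [eventually_inf_principal]
  filter_upwards [hnorm.eventually_ge_atTop (2 * max R 1),
    hdiv.eventually (gt_mem_nhds (half_pos hε))] with p h1 h2 hp
  have h3 := norm_poissonIntegral_le hm hb hδ0.le (lt_max_of_lt_right one_pos) hR' hp h1
  rw [dist_zero_right]
  have h4 : ‖poissonConst m‖ * (δ * K) ≤ ε / 2 := by
    have : δ * (‖poissonConst m‖ * K + 1) = ε / 2 := div_mul_cancel₀ _ hden.ne'
    nlinarith
  linarith

/-- No equation is involved: if `U` is small off a compact `K` and `y` is outside the projection of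
`K`, then `U` is small near `(0, y)`, hence so is its limit `u y`. -/
theorem tendsto_zero_of_vanishesAtInfinity {U : ℝ × ℝ → ℂ} (hU : VanishesAtInfinity U)
    (hUu : HasBoundaryValues U u) : Tendsto u (cocompact ℝ) (𝓝 0) := by
  rw [Metric.tendsto_nhds]
  intro ε hε
  have h := (Metric.tendsto_nhds.1 hU) (ε / 2) (half_pos hε)
  rw [eventually_inf_principal] at h
  obtain ⟨K, hK, hKs⟩ := mem_cocompact.1 h
  filter_upwards [(hK.image continuous_snd).compl_mem_cocompact] with y hy
  have hmem : Kᶜ ∈ 𝓝 ((0 : ℝ), y) :=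
    hK.isClosed.isOpen_compl.mem_nhds fun h' => hy ⟨_, h', rfl⟩
  have hne : (𝓝[rightHalfPlane] ((0 : ℝ), y)).NeBot := by
    rw [← mem_closure_iff_nhdsWithin_neBot]
    have : rightHalfPlane = Set.Ioi (0 : ℝ) ×ˢ (Set.univ : Set ℝ) := by
      ext p; simp [rightHalfPlane]
    rw [this, closure_prod_eq, closure_Ioi]
    simp
  have hle : ‖(u y : ℂ)‖ ≤ ε / 2 := by
    refine le_of_tendsto (hUu y).norm ?_
    filter_upwards [mem_nhdsWithin_of_mem_nhds hmem, self_mem_nhdsWithin] with p hp hpH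
    simpa using (hKs hp hpH : dist (U p) 0 < ε / 2).le
  rw [dist_zero_right, Real.norm_eq_abs]
  rw [Complex.norm_real, Real.norm_eq_abs] at hle
  linarith

end

/-! ### Regularity of partial derivatives and of test functions -/

theorem hasDerivAt_partialX {U : ℝ × ℝ → ℂ} (hU : ContDiffOn ℝ 1 U rightHalfPlane) {p : ℝ × ℝ}
    (hp : p ∈ rightHalfPlane) :
    HasDerivAt (fun t => U (t, p.2)) (partialX U p) p.1 ∧ partialX U p = fderiv ℝ U p (1, 0) := by
  have h1 : HasDerivAt (fun t : ℝ => (t, p.2)) ((1 : ℝ), (0 : ℝ)) p.1 :=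
    (hasDerivAt_id _).prodMk (hasDerivAt_const _ _)
  have hd : DifferentiableAt ℝ U p :=
    (hU.differentiableOn one_ne_zero).differentiableAt (isOpen_rightHalfPlane.mem_nhds hp)
  have h2 : HasDerivAt (fun t => U (t, p.2)) (fderiv ℝ U p (1, 0)) p.1 :=
    hd.hasFDerivAt.comp_hasDerivAt p.1 h1
  exact ⟨by rw [partialX, h2.deriv]; exact h2, h2.deriv⟩

theorem hasDerivAt_partialY {U : ℝ × ℝ → ℂ} (hU : ContDiffOn ℝ 1 U rightHalfPlane) {p : ℝ × ℝ}
    (hp : p ∈ rightHalfPlane) :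
    HasDerivAt (fun t => U (p.1, t)) (partialY U p) p.2 ∧ partialY U p = fderiv ℝ U p (0, 1) := by
  have h1 : HasDerivAt (fun t : ℝ => (p.1, t)) ((0 : ℝ), (1 : ℝ)) p.2 :=
    (hasDerivAt_const _ _).prodMk (hasDerivAt_id _)
  have hd : DifferentiableAt ℝ U p :=
    (hU.differentiableOn one_ne_zero).differentiableAt (isOpen_rightHalfPlane.mem_nhds hp)
  have h2 : HasDerivAt (fun t => U (p.1, t)) (fderiv ℝ U p (0, 1)) p.2 :=
    hd.hasFDerivAt.comp_hasDerivAt p.2 h1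
  exact ⟨by rw [partialY, h2.deriv]; exact h2, h2.deriv⟩

theorem contDiffOn_partialX {U : ℝ × ℝ → ℂ} {n : ℕ}
    (hU : ContDiffOn ℝ (n + 1 : ℕ) U rightHalfPlane) :
    ContDiffOn ℝ n (partialX U) rightHalfPlane := by
  have h := hU.fderiv_of_isOpen isOpen_rightHalfPlane (m := n) (by norm_cast)
  refine (h.clm_apply (contDiffOn_const (c := ((1 : ℝ), (0 : ℝ))))).congr fun p hp => ?_
  exact (hasDerivAt_partialX (hU.of_le (by exact_mod_cast Nat.le_add_left 1 n)) hp).2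

theorem contDiffOn_partialY {U : ℝ × ℝ → ℂ} {n : ℕ}
    (hU : ContDiffOn ℝ (n + 1 : ℕ) U rightHalfPlane) :
    ContDiffOn ℝ n (partialY U) rightHalfPlane := by
  have h := hU.fderiv_of_isOpen isOpen_rightHalfPlane (m := n) (by norm_cast)
  refine (h.clm_apply (contDiffOn_const (c := ((0 : ℝ), (1 : ℝ))))).congr fun p hp => ?_
  exact (hasDerivAt_partialY (hU.of_le (by exact_mod_cast Nat.le_add_left 1 n)) hp).2

/-- `f` is twice continuously differentiable with derivatives `f₁` and `f₂`. -/
structure HasTwoDerivs (f f₁ f₂ : ℝ → ℝ) : Prop where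
  fst : ∀ x, HasDerivAt f (f₁ x) x
  snd : ∀ x, HasDerivAt f₁ (f₂ x) x
  cont : Continuous f₂

namespace HasTwoDerivs

variable {f f₁ f₂ g g₁ g₂ : ℝ → ℝ}

theorem cont_fst (h : HasTwoDerivs f f₁ f₂) : Continuous f₁ :=
  continuous_iff_continuousAt.2 fun x => (h.snd x).continuousAt

theorem cont_zero (h : HasTwoDerivs f f₁ f₂) : Continuous f :=
  continuous_iff_continuousAt.2 fun x => (h.fst x).continuousAt

theorem mul (hf : HasTwoDerivs f f₁ f₂) (hg : HasTwoDerivs g g₁ g₂) :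
    HasTwoDerivs (fun x => f x * g x) (fun x => f₁ x * g x + f x * g₁ x)
      (fun x => f₂ x * g x + 2 * (f₁ x * g₁ x) + f x * g₂ x) where
  fst x := (hf.fst x).mul (hg.fst x)
  snd x := by
    refine (((hf.snd x).mul (hg.fst x)).add ((hf.fst x).mul (hg.snd x))).congr_deriv ?_
    ring
  cont := by
    have := hf.cont; have := hf.cont_fst; have := hf.cont_zero
    have := hg.cont; have := hg.cont_fst; have := hg.cont_zero
    fun_prop

theorem comp_mul_left (hf : HasTwoDerivs f f₁ f₂) (c : ℝ) :
    HasTwoDerivs (fun x => f (c * x)) (fun x => c * f₁ (c * x)) (fun x => c ^ 2 * f₂ (c * x)) where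
  fst x := by
    have h : HasDerivAt (fun x => c * x) c x := by simpa using (hasDerivAt_id x).const_mul c
    exact ((hf.fst (c * x)).comp x h).congr_deriv (mul_comm _ _)
  snd x := by
    have h : HasDerivAt (fun x => c * x) c x := by simpa using (hasDerivAt_id x).const_mul c
    refine (((hf.snd (c * x)).comp x h).const_mul c).congr_deriv ?_
    ring
  cont := by
    have := hf.cont
    fun_prop

theorem of_contDiff (hf : ContDiff ℝ 2 f) : HasTwoDerivs f (deriv f) (deriv (deriv f)) := by
  have h1 : ContDiff ℝ 1 (deriv f) := by
    have : ContDiff ℝ (1 + 1) f := by simpa [one_add_one_eq_two] using hf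
    exact (contDiff_succ_iff_deriv.1 this).2.2
  exact ⟨fun x => (hf.differentiable two_ne_zero x).hasDerivAt,
    fun x => (h1.differentiable one_ne_zero x).hasDerivAt, h1.continuous_deriv le_rfl⟩

end HasTwoDerivs

/-- The adjoint operator applied to the test function `x E(x) B(y)`, multiplied out. -/
def adjointTest (m : ℂ) (E E₁ E₂ B B₂ : ℝ → ℝ) (p : ℝ × ℝ) : ℂ :=
  (p.1 * E₂ p.1 + (2 - m) * E₁ p.1) * B p.2 + p.1 * E p.1 * B₂ p.2

/-! ### Green's identity for compactly supported test functions -/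

section

variable {m : ℂ} {U : ℝ × ℝ → ℂ} {E E₁ E₂ B B₁ B₂ : ℝ → ℝ}

/-- The integrand is the `x`-derivative of `U_x · xE - U · (xE)' + m U E`, which vanishes at both
ends. -/
theorem setIntegral_Icc_weinstein_fst (hU : ContDiffOn ℝ 2 U rightHalfPlane) {a b : ℝ}
    (ha : 0 < a) (hab : a ≤ b) (hE : HasTwoDerivs E E₁ E₂) (h0 : E a = 0 ∧ E b = 0)
    (h1 : E₁ a = 0 ∧ E₁ b = 0) (y : ℝ) :
    ∫ x in Set.Icc a b, ((partialX (partialX U) (x, y) + m / x * partialX U (x, y)) * (x * E x) -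
      U (x, y) * (x * E₂ x + (2 - m) * E₁ x)) = 0 := by
  have hX : ContDiffOn ℝ 1 (partialX U) rightHalfPlane := by
    exact_mod_cast contDiffOn_partialX (n := 1) (by exact_mod_cast hU)
  have hU1 : ContDiffOn ℝ 1 U rightHalfPlane := hU.of_le (by norm_num)
  have hXX : ContinuousOn (partialX (partialX U)) rightHalfPlane := by
    have := contDiffOn_partialX (n := 0) (by exact_mod_cast hX)
    exact this.continuousOn
  have hmem : ∀ x ∈ Set.Icc a b, (x, y) ∈ rightHalfPlane := fun x hx => ha.trans_le hx.1
  have hline : ContinuousOn (fun x : ℝ => (x, y)) (Set.Icc a b) := by fun_prop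
  have c0 := hU1.continuousOn.comp hline hmem
  have c1 := hX.continuousOn.comp hline hmem
  have c2 := hXX.comp hline hmem
  have hE0 := hE.cont_zero
  have hE1 := hE.cont_fst
  have hE2 := hE.cont
  have hderiv : ∀ x ∈ Set.uIcc a b, HasDerivAt
      (fun x : ℝ => partialX U (x, y) * (x * E x) - U (x, y) * (E x + x * E₁ x) +
        m * (U (x, y) * E x))
      ((partialX (partialX U) (x, y) + m / x * partialX U (x, y)) * (x * E x) -
      U (x, y) * (x * E₂ x + (2 - m) * E₁ x)) x := by
    intro x hx
    rw [Set.uIcc_of_le hab] at hx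
    have hx0 : (x : ℂ) ≠ 0 := by exact_mod_cast (ha.trans_le hx.1).ne'
    have d0 := (hasDerivAt_partialX hU1 (hmem x hx)).1
    have d1 := (hasDerivAt_partialX hX (hmem x hx)).1
    have e0 := (hE.fst x).ofReal_comp
    have e1 := (hE.snd x).ofReal_comp
    have ex := (hasDerivAt_id x).ofReal_comp
    simp only [id, Complex.ofReal_one] at ex
    refine (((d1.mul (ex.mul e0)).sub (d0.mul (e0.add (ex.mul e1)))).add
      ((d0.mul e0).const_mul m)).congr_deriv ?_
    simp only [Pi.mul_apply, Pi.add_apply]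
    field_simp
    ring
  rw [integral_Icc_eq_integral_Ioc, ← intervalIntegral.integral_of_le hab,
    intervalIntegral.integral_eq_sub_of_hasDerivAt hderiv]
  · simp [h0, h1]
  · refine ContinuousOn.intervalIntegrable ?_
    rw [Set.uIcc_of_le hab]
    have hdiv : ContinuousOn (fun x : ℝ => m / (x : ℂ)) (Set.Icc a b) := by
      refine continuousOn_const.div (by fun_prop) fun x hx => ?_
      exact_mod_cast (ha.trans_le hx.1).ne'
    exact ((c2.add (hdiv.mul c1)).mul (by fun_prop)).sub (c0.mul (by fun_prop))

theorem setIntegral_Icc_weinstein_snd (hU : ContDiffOn ℝ 2 U rightHalfPlane) {c d : ℝ}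
    (hcd : c ≤ d) (hB : HasTwoDerivs B B₁ B₂) (h0 : B c = 0 ∧ B d = 0)
    (h1 : B₁ c = 0 ∧ B₁ d = 0) {x : ℝ} (hx : 0 < x) :
    ∫ y in Set.Icc c d, (partialY (partialY U) (x, y) * B y - U (x, y) * B₂ y) = 0 := by
  have hY : ContDiffOn ℝ 1 (partialY U) rightHalfPlane := by
    exact_mod_cast contDiffOn_partialY (n := 1) (by exact_mod_cast hU)
  have hU1 : ContDiffOn ℝ 1 U rightHalfPlane := hU.of_le (by norm_num)
  have hYY : ContinuousOn (partialY (partialY U)) rightHalfPlane := by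
    have := contDiffOn_partialY (n := 0) (by exact_mod_cast hY)
    exact this.continuousOn
  have hmem : ∀ y ∈ Set.Icc c d, (x, y) ∈ rightHalfPlane := fun y _ => hx
  have hline : ContinuousOn (fun y : ℝ => (x, y)) (Set.Icc c d) := by fun_prop
  have c0 := hU1.continuousOn.comp hline hmem
  have c2 := hYY.comp hline hmem
  have hB0 := hB.cont_zero
  have hB2 := hB.cont
  have hderiv : ∀ y ∈ Set.uIcc c d, HasDerivAt
      (fun y : ℝ => partialY U (x, y) * B y - U (x, y) * B₁ y)
      (partialY (partialY U) (x, y) * B y - U (x, y) * B₂ y) y := by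
    intro y hy
    rw [Set.uIcc_of_le hcd] at hy
    have d0 := (hasDerivAt_partialY hU1 (hmem y hy)).1
    have d1 := (hasDerivAt_partialY hY (hmem y hy)).1
    refine ((d1.mul (hB.fst y).ofReal_comp).sub (d0.mul (hB.snd y).ofReal_comp)).congr_deriv ?_
    ring
  rw [integral_Icc_eq_integral_Ioc, ← intervalIntegral.integral_of_le hcd,
    intervalIntegral.integral_eq_sub_of_hasDerivAt hderiv]
  · simp [h0, h1]
  · refine ContinuousOn.intervalIntegrable ?_
    rw [Set.uIcc_of_le hcd]
    exact (c2.mul (by fun_prop)).sub (c0.mul (by fun_prop))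

/-- Green's identity on a rectangle. Since the test function is a product, the `x`-part vanishes
when integrated first in `x`, and the `y`-part when integrated first in `y`. -/
theorem integral_mul_adjointTest_of_compact (hU : IsAxisymmetricPotential m U) {a b c d : ℝ}
    (ha : 0 < a) (hab : a ≤ b) (hcd : c ≤ d) (hE : HasTwoDerivs E E₁ E₂)
    (hB : HasTwoDerivs B B₁ B₂) (hEs : ∀ x ∉ Set.Ioo a b, E x = 0 ∧ E₁ x = 0 ∧ E₂ x = 0)
    (hBs : ∀ y ∉ Set.Ioo c d, B y = 0 ∧ B₁ y = 0 ∧ B₂ y = 0) :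
    ∫ p : ℝ × ℝ, U p * adjointTest m E E₁ E₂ B B₂ p = 0 := by
  set R := Set.Icc a b ×ˢ Set.Icc c d with hR
  have hRc : IsCompact R := isCompact_Icc.prod isCompact_Icc
  have hRH : R ⊆ rightHalfPlane := fun p hp => ha.trans_le hp.1.1
  have hX : ContDiffOn ℝ 1 (partialX U) rightHalfPlane := by
    exact_mod_cast contDiffOn_partialX (n := 1) (by exact_mod_cast hU.1)
  have hXX : ContinuousOn (partialX (partialX U)) rightHalfPlane :=
    (contDiffOn_partialX (n := 0) (by exact_mod_cast hX)).continuousOn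
  have hY : ContDiffOn ℝ 1 (partialY U) rightHalfPlane := by
    exact_mod_cast contDiffOn_partialY (n := 1) (by exact_mod_cast hU.1)
  have hYY : ContinuousOn (partialY (partialY U)) rightHalfPlane :=
    (contDiffOn_partialY (n := 0) (by exact_mod_cast hY)).continuousOn
  have hE0 := hE.cont_zero
  have hE1 := hE.cont_fst
  have hE2 := hE.cont
  have hB0 := hB.cont_zero
  have hB2 := hB.cont
  have c0 := hU.1.continuousOn.mono hRH
  have c1 := hX.continuousOn.mono hRH
  have c2 := hXX.mono hRH
  have c3 := hYY.mono hRH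
  have hdiv : ContinuousOn (fun p : ℝ × ℝ => m / (p.1 : ℂ)) R := by
    refine continuousOn_const.div (by fun_prop) fun p hp => ?_
    exact_mod_cast (ha.trans_le hp.1.1).ne'
  set F : ℝ × ℝ → ℂ := fun p => ((partialX (partialX U) p + m / p.1 * partialX U p) *
    (p.1 * E p.1) - U p * (p.1 * E₂ p.1 + (2 - m) * E₁ p.1)) * B p.2 with hF
  set G : ℝ × ℝ → ℂ := fun p => (partialY (partialY U) p * B p.2 - U p * B₂ p.2) *
    (p.1 * E p.1) with hG
  have hFi : IntegrableOn F R (volume.prod volume) := ContinuousOn.integrableOn_compact hRc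
    ((((c2.add (hdiv.mul c1)).mul (by fun_prop)).sub (c0.mul (by fun_prop))).mul (by fun_prop))
  have hGi : IntegrableOn G R (volume.prod volume) := ContinuousOn.integrableOn_compact hRc
    (((c3.mul (by fun_prop)).sub (c0.mul (by fun_prop))).mul (by fun_prop))
  have hFz : ∫ p in R, F p ∂(volume.prod volume) = 0 := by
    have hFi' : IntegrableOn (fun z : ℝ × ℝ => F z.swap) (Set.Icc c d ×ˢ Set.Icc a b)
        (volume.prod volume) := hFi.swap
    rw [← setIntegral_prod_swap, setIntegral_prod _ hFi']
    refine (setIntegral_congr_fun measurableSet_Icc fun y _ => ?_).trans (integral_zero _ _)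
    simp only [Prod.swap_prod_mk, hF]
    rw [integral_mul_const, setIntegral_Icc_weinstein_fst hU.1 ha hab hE
      ⟨(hEs a (by simp)).1, (hEs b (by simp)).1⟩ ⟨(hEs a (by simp)).2.1, (hEs b (by simp)).2.1⟩,
      zero_mul]
  have hGz : ∫ p in R, G p ∂(volume.prod volume) = 0 := by
    rw [setIntegral_prod _ hGi]
    refine (setIntegral_congr_fun measurableSet_Icc fun x hx => ?_).trans (integral_zero _ _)
    simp only [hG]
    rw [integral_mul_const, setIntegral_Icc_weinstein_snd hU.1 hcd hB
      ⟨(hBs c (by simp)).1, (hBs d (by simp)).1⟩ ⟨(hBs c (by simp)).2.1, (hBs d (by simp)).2.1⟩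
      (ha.trans_le hx.1), zero_mul]
  have hsum : ∀ p ∈ R, U p * adjointTest m E E₁ E₂ B B₂ p = -(F p + G p) := fun p hp => by
    have h := hU.2 p (hRH hp)
    rw [weinsteinOp] at h
    simp only [hF, hG, adjointTest]
    linear_combination (p.1 * E p.1 * B p.2 : ℂ) * h
  rw [← setIntegral_eq_integral_of_forall_compl_eq_zero (s := R)]
  · rw [setIntegral_congr_fun (measurableSet_Icc.prod measurableSet_Icc) hsum, integral_neg,
      Measure.volume_eq_prod, integral_add hFi hGi, hFz, hGz]
    simp
  · intro p hp
    rw [adjointTest]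
    by_cases hx : p.1 ∈ Set.Ioo a b
    · have hy : p.2 ∉ Set.Ioo c d := fun hy =>
        hp ⟨Set.Ioo_subset_Icc_self hx, Set.Ioo_subset_Icc_self hy⟩
      simp [hBs _ hy]
    · simp [hEs _ hx]

end

/-! ### Cutoff functions -/

/-- The pointwise `C²` size of a function with derivatives `f₁`, `f₂`. -/
def derivNorm (f f₁ f₂ : ℝ → ℝ) (x : ℝ) : ℝ := |f x| + |f₁ x| + |f₂ x|

theorem derivNorm_nonneg (f f₁ f₂ : ℝ → ℝ) (x : ℝ) : 0 ≤ derivNorm f f₁ f₂ x := by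
  rw [derivNorm]; positivity

theorem abs_mul_derivs_le {f f₁ f₂ g g₁ g₂ C : ℝ} (h0 : |g| ≤ C) (h1 : |g₁| ≤ C)
    (h2 : |g₂| ≤ C) :
    |f * g| ≤ 2 * C * (|f| + |f₁| + |f₂|) ∧ |f₁ * g + f * g₁| ≤ 2 * C * (|f| + |f₁| + |f₂|) ∧
      |f₂ * g + 2 * (f₁ * g₁) + f * g₂| ≤ 2 * C * (|f| + |f₁| + |f₂|) := by
  have hC : 0 ≤ C := (abs_nonneg _).trans h0
  have key : ∀ r s : ℝ, |s| ≤ C → |r * s| ≤ C * |r| := fun r s h => by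
    rw [abs_mul, mul_comm]; gcongr
  have p1 := mul_nonneg hC (abs_nonneg f)
  have p2 := mul_nonneg hC (abs_nonneg f₁)
  have p3 := mul_nonneg hC (abs_nonneg f₂)
  refine ⟨?_, ?_, ?_⟩
  · linarith [key f g h0]
  · linarith [abs_add_le (f₁ * g) (f * g₁), key f₁ g h0, key f g₁ h1]
  · have e : |2 * (f₁ * g₁)| = 2 * |f₁ * g₁| := by rw [abs_mul, abs_two]
    linarith [abs_add_le (f₂ * g + 2 * (f₁ * g₁)) (f * g₂), abs_add_le (f₂ * g) (2 * (f₁ * g₁)),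
      key f₂ g h0, key f₁ g₁ h1, key f g₂ h2]

theorem exists_bound_of_eventually_const {f : ℝ → ℝ} (hf : Continuous f) {a b k l : ℝ}
    (ha : ∀ x < a, f x = k) (hb : ∀ x > b, f x = l) : ∃ C, ∀ x, |f x| ≤ C := by
  obtain ⟨C, hC⟩ := isCompact_Icc.exists_bound_of_continuousOn (s := Set.Icc a b) hf.continuousOn
  refine ⟨max C (max |k| |l|), fun x => ?_⟩
  rcases lt_or_ge x a with h | h
  · rw [ha x h]; exact (le_max_left _ _).trans (le_max_right _ _)
  rcases lt_or_ge b x with h' | h'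
  · rw [hb x h']; exact (le_max_right _ _).trans (le_max_right _ _)
  · exact (hC x ⟨h, h'⟩).trans (le_max_left _ _)

theorem deriv_eq_zero_of_eqOn_const {f : ℝ → ℝ} {s : Set ℝ} (hs : IsOpen s) {k : ℝ}
    (h : ∀ x ∈ s, f x = k) : ∀ x ∈ s, deriv f x = 0 := fun x hx => by
  have : f =ᶠ[𝓝 x] fun _ => k := by
    filter_upwards [hs.mem_nhds hx] with y hy using h y hy
  rw [this.deriv_eq, deriv_const]

/-- A smooth step from `0` (left of `1`) to `1` (right of `2`). -/
theorem exists_step : ∃ (χ χ₁ χ₂ : ℝ → ℝ) (C : ℝ), HasTwoDerivs χ χ₁ χ₂ ∧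
    (∀ x < 1, χ x = 0 ∧ χ₁ x = 0 ∧ χ₂ x = 0) ∧ (∀ x > 2, χ x = 1 ∧ χ₁ x = 0 ∧ χ₂ x = 0) ∧
    ∀ x, |χ x| ≤ C ∧ |χ₁ x| ≤ C ∧ |χ₂ x| ≤ C := by
  set χ : ℝ → ℝ := fun x => Real.smoothTransition (x - 1) with hχ
  have hc : ContDiff ℝ 2 χ := Real.smoothTransition.contDiff.comp (contDiff_id.sub contDiff_const)
  have hd := HasTwoDerivs.of_contDiff hc
  have l0 : ∀ x ∈ Set.Iio (1 : ℝ), χ x = 0 := fun x hx =>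
    Real.smoothTransition.zero_of_nonpos (by linarith [Set.mem_Iio.1 hx])
  have r0 : ∀ x ∈ Set.Ioi (2 : ℝ), χ x = 1 := fun x hx =>
    Real.smoothTransition.one_of_one_le (by linarith [Set.mem_Ioi.1 hx])
  have l1 := deriv_eq_zero_of_eqOn_const isOpen_Iio l0
  have r1 := deriv_eq_zero_of_eqOn_const isOpen_Ioi r0
  have l2 := deriv_eq_zero_of_eqOn_const isOpen_Iio l1
  have r2 := deriv_eq_zero_of_eqOn_const isOpen_Ioi r1
  obtain ⟨C0, h0⟩ := exists_bound_of_eventually_const hd.cont_zero l0 r0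
  obtain ⟨C1, h1⟩ := exists_bound_of_eventually_const hd.cont_fst l1 r1
  obtain ⟨C2, h2⟩ := exists_bound_of_eventually_const hd.cont l2 r2
  refine ⟨χ, _, _, max C0 (max C1 C2), hd, fun x hx => ⟨l0 x hx, l1 x hx, l2 x hx⟩,
    fun x hx => ⟨r0 x hx, r1 x hx, r2 x hx⟩, fun x => ⟨?_, ?_, ?_⟩⟩
  · exact (h0 x).trans (le_max_left _ _)
  · exact (h1 x).trans ((le_max_left _ _).trans (le_max_right _ _))
  · exact (h2 x).trans ((le_max_right _ _).trans (le_max_right _ _))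

/-- A smooth cutoff function. -/
theorem exists_cutoff : ∃ (η η₁ η₂ : ℝ → ℝ) (C : ℝ), HasTwoDerivs η η₁ η₂ ∧
    (∀ x, |x| < 1 → η x = 1 ∧ η₁ x = 0 ∧ η₂ x = 0) ∧
    (∀ x, 2 < |x| → η x = 0 ∧ η₁ x = 0 ∧ η₂ x = 0) ∧
    ∀ x, |η x| ≤ C ∧ |η₁ x| ≤ C ∧ |η₂ x| ≤ C := by
  let φ : ContDiffBump (0 : ℝ) := ⟨1, 2, one_pos, one_lt_two⟩
  have hd := HasTwoDerivs.of_contDiff (φ.contDiff (n := 2))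
  have o1 : IsOpen {x : ℝ | |x| < 1} := isOpen_lt continuous_abs continuous_const
  have o2 : IsOpen {x : ℝ | 2 < |x|} := isOpen_lt continuous_const continuous_abs
  have l0 : ∀ x ∈ {x : ℝ | |x| < 1}, φ x = 1 := fun x hx =>
    φ.one_of_mem_closedBall (by simpa using le_of_lt hx)
  have r0 : ∀ x ∈ {x : ℝ | 2 < |x|}, φ x = 0 := fun x hx =>
    φ.zero_of_le_dist (by simpa using le_of_lt hx)
  have l1 := deriv_eq_zero_of_eqOn_const o1 l0
  have r1 := deriv_eq_zero_of_eqOn_const o2 r0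
  have l2 := deriv_eq_zero_of_eqOn_const o1 l1
  have r2 := deriv_eq_zero_of_eqOn_const o2 r1
  have bd : ∀ f : ℝ → ℝ, Continuous f → (∀ x ∈ {x : ℝ | 2 < |x|}, f x = 0) →
      ∃ C, ∀ x, |f x| ≤ C := fun f hf h =>
    exists_bound_of_eventually_const (a := -2) (b := 2) hf
      (fun x hx => h x (lt_abs.2 (Or.inr (show (2 : ℝ) < -x by linarith))))
      (fun x hx => h x (lt_abs.2 (Or.inl hx)))
  obtain ⟨C0, h0⟩ := bd _ hd.cont_zero r0
  obtain ⟨C1, h1⟩ := bd _ hd.cont_fst r1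
  obtain ⟨C2, h2⟩ := bd _ hd.cont r2
  refine ⟨φ, _, _, max C0 (max C1 C2), hd, fun x hx => ⟨l0 x hx, l1 x hx, l2 x hx⟩,
    fun x hx => ⟨r0 x hx, r1 x hx, r2 x hx⟩, fun x => ⟨?_, ?_, ?_⟩⟩
  · exact (h0 x).trans (le_max_left _ _)
  · exact (h1 x).trans ((le_max_left _ _).trans (le_max_right _ _))
  · exact (h2 x).trans ((le_max_right _ _).trans (le_max_right _ _))

theorem abs_scaled_derivs_le {c C x y z : ℝ} (hc : 0 ≤ c) (hx : |x| ≤ C) (hy : |y| ≤ C)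
    (hz : |z| ≤ C) : |x| ≤ C * (1 + c) ^ 2 ∧ |c * y| ≤ C * (1 + c) ^ 2 ∧
      |c ^ 2 * z| ≤ C * (1 + c) ^ 2 := by
  have hC : 0 ≤ C := (abs_nonneg _).trans hx
  rw [abs_mul, abs_mul, abs_of_nonneg hc, abs_of_nonneg (sq_nonneg c)]
  have h1 : 1 ≤ (1 + c) ^ 2 := by nlinarith
  have h2 : c ≤ (1 + c) ^ 2 := by nlinarith
  have h3 : c ^ 2 ≤ (1 + c) ^ 2 := by nlinarith
  refine ⟨?_, ?_, ?_⟩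
  · nlinarith
  · calc c * |y| ≤ (1 + c) ^ 2 * C := by gcongr
      _ = _ := mul_comm _ _
  · calc c ^ 2 * |z| ≤ (1 + c) ^ 2 * C := by gcongr
      _ = _ := mul_comm _ _

/-- Multiply by a cutoff dilated by `n + 1`. Its derivatives only shrink as `n` grows, so the
product is dominated uniformly in `n` by the pointwise `C²` size of `f`. -/
theorem exists_compact_approx {f f₁ f₂ : ℝ → ℝ} (hf : HasTwoDerivs f f₁ f₂) :
    ∃ (g g₁ g₂ : ℕ → ℝ → ℝ) (C : ℝ), 0 ≤ C ∧ (∀ n, HasTwoDerivs (g n) (g₁ n) (g₂ n)) ∧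
      (∀ (n : ℕ) x, f x = 0 → f₁ x = 0 → f₂ x = 0 → g n x = 0 ∧ g₁ n x = 0 ∧ g₂ n x = 0) ∧
      (∀ (n : ℕ) x, 2 * ((n : ℝ) + 1) < |x| → g n x = 0 ∧ g₁ n x = 0 ∧ g₂ n x = 0) ∧
      (∀ x, ∀ᶠ n in atTop, g n x = f x ∧ g₁ n x = f₁ x ∧ g₂ n x = f₂ x) ∧
      (∀ (n : ℕ) x, |g n x| ≤ C * derivNorm f f₁ f₂ x ∧ |g₁ n x| ≤ C * derivNorm f f₁ f₂ x ∧
        |g₂ n x| ≤ C * derivNorm f f₁ f₂ x) := by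
  obtain ⟨η, η₁, η₂, C, hη, h1, h0, hC⟩ := exists_cutoff
  have hC0 : 0 ≤ C := (abs_nonneg _).trans (hC 0).1
  set c : ℕ → ℝ := fun n => ((n : ℝ) + 1)⁻¹ with hcdef
  have hc0 : ∀ n, 0 < c n := fun n => by simp only [hcdef]; positivity
  have hc1 : ∀ n, c n ≤ 1 := fun n => inv_le_one_of_one_le₀ (by linarith [n.cast_nonneg (α := ℝ)])
  have habs : ∀ (n : ℕ) x, |c n * x| = |x| / ((n : ℝ) + 1) := fun n x => by
    rw [abs_mul, abs_of_pos (hc0 n), div_eq_inv_mul]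
  refine ⟨fun n x => f x * η (c n * x), fun n x => f₁ x * η (c n * x) + f x * (c n * η₁ (c n * x)),
    fun n x => f₂ x * η (c n * x) + 2 * (f₁ x * (c n * η₁ (c n * x))) +
      f x * (c n ^ 2 * η₂ (c n * x)), 2 * (C * 4), by positivity,
    fun n => hf.mul (hη.comp_mul_left (c n)), ?_, ?_, ?_, ?_⟩
  · intro n x e0 e1 e2
    simp [e0, e1, e2]
  · intro n x hx
    obtain ⟨e0, e1, e2⟩ := h0 (c n * x) (by rw [habs]; exact (lt_div_iff₀ (by positivity)).2 hx)
    simp [e0, e1, e2]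
  · intro x
    obtain ⟨N, hN⟩ := exists_nat_gt |x|
    filter_upwards [eventually_ge_atTop N] with n hn
    have hn' : (N : ℝ) ≤ n := by exact_mod_cast hn
    obtain ⟨e0, e1, e2⟩ := h1 (c n * x) (by
      rw [habs]; exact (div_lt_one (by positivity)).2 (by linarith))
    simp [e0, e1, e2]
  · intro n x
    obtain ⟨b0, b1, b2⟩ := hC (c n * x)
    obtain ⟨b0, b1, b2⟩ := abs_scaled_derivs_le (hc0 n).le b0 b1 b2
    have : C * (1 + c n) ^ 2 ≤ C * 4 := by
      gcongr
      nlinarith [hc0 n, hc1 n]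
    exact abs_mul_derivs_le (b0.trans this) (b1.trans this) (b2.trans this)

/-! ### Test functions that are not compactly supported -/

section

variable {m : ℂ} {W : ℝ × ℝ → ℂ} {M : ℝ} {E E₁ E₂ B B₁ B₂ : ℝ → ℝ}

theorem norm_adjointTest_le {e b : ℝ} {p : ℝ × ℝ} (h0 : |E p.1| ≤ e) (h1 : |E₁ p.1| ≤ e)
    (h2 : |E₂ p.1| ≤ e) (k0 : |B p.2| ≤ b) (k2 : |B₂ p.2| ≤ b) :
    ‖adjointTest m E E₁ E₂ B B₂ p‖ ≤ (2 + ‖2 - m‖) * ((1 + |p.1|) * e * b) := by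
  have he : 0 ≤ e := (abs_nonneg _).trans h0
  have hb : 0 ≤ b := (abs_nonneg _).trans k0
  rw [adjointTest]
  calc _ ≤ (|p.1| * e + ‖2 - m‖ * e) * b + |p.1| * e * b := by
        refine (norm_add_le _ _).trans (add_le_add ?_ ?_)
        · rw [norm_mul, Complex.norm_real, Real.norm_eq_abs]
          refine mul_le_mul ((norm_add_le _ _).trans (add_le_add ?_ ?_)) k0 (abs_nonneg _)
            (by positivity)
          · rw [norm_mul, Complex.norm_real, Complex.norm_real, Real.norm_eq_abs, Real.norm_eq_abs]
            gcongr
          · rw [norm_mul, Complex.norm_real, Real.norm_eq_abs]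
            gcongr
        · simp only [norm_mul, Complex.norm_real, Real.norm_eq_abs]
          gcongr
    _ ≤ _ := by
        have h1 := mul_nonneg he hb
        have h3 := mul_nonneg (norm_nonneg (2 - m)) (mul_nonneg (abs_nonneg p.1) h1)
        nlinarith

theorem continuous_adjointTest (hE : HasTwoDerivs E E₁ E₂) (hB : HasTwoDerivs B B₁ B₂) :
    Continuous (adjointTest m E E₁ E₂ B B₂) := by
  have := hE.cont; have := hE.cont_fst; have := hE.cont_zero
  have := hB.cont; have := hB.cont_zero
  unfold adjointTest
  fun_prop

theorem integrable_mul_adjointTest (hW : Continuous W) (hM : ∀ p, ‖W p‖ ≤ M)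
    (hE : HasTwoDerivs E E₁ E₂) (hB : HasTwoDerivs B B₁ B₂)
    (hEi : Integrable fun x => (1 + |x|) * derivNorm E E₁ E₂ x)
    (hBi : Integrable (derivNorm B B₁ B₂)) :
    Integrable fun p => W p * adjointTest m E E₁ E₂ B B₂ p := by
  have h := ((hEi.mul_prod hBi).const_mul (M * (2 + ‖2 - m‖)))
  refine h.mono' (hW.mul (continuous_adjointTest hE hB)).aestronglyMeasurable
    (Eventually.of_forall fun p => ?_)
  rw [norm_mul]
  have hM0 : 0 ≤ M := (norm_nonneg _).trans (hM 0)
  have hb := norm_adjointTest_le (m := m) (E := E) (E₁ := E₁) (E₂ := E₂) (B := B) (B₂ := B₂)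
    (e := derivNorm E E₁ E₂ p.1) (b := derivNorm B B₁ B₂ p.2) (p := p)
    (by rw [derivNorm]; linarith [abs_nonneg (E₁ p.1), abs_nonneg (E₂ p.1)])
    (by rw [derivNorm]; linarith [abs_nonneg (E p.1), abs_nonneg (E₂ p.1)])
    (by rw [derivNorm]; linarith [abs_nonneg (E p.1), abs_nonneg (E₁ p.1)])
    (by rw [derivNorm]; linarith [abs_nonneg (B₁ p.2), abs_nonneg (B₂ p.2)])
    (by rw [derivNorm]; linarith [abs_nonneg (B p.2), abs_nonneg (B₁ p.2)])
  calc ‖W p‖ * _ ≤ M * _ := mul_le_mul (hM p) hb (norm_nonneg _) hM0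
    _ = _ := by ring

/-- Cut off both factors at infinity and pass to the limit by dominated convergence. The boundary
plays no role yet, as `E` vanishes near it. -/
theorem integral_mul_adjointTest_of_pos (hU : IsAxisymmetricPotential m W) (hW : Continuous W)
    (hM : ∀ p, ‖W p‖ ≤ M) (hE : HasTwoDerivs E E₁ E₂) (hB : HasTwoDerivs B B₁ B₂)
    {a : ℝ} (ha : 0 < a) (hEa : ∀ x ≤ a, E x = 0 ∧ E₁ x = 0 ∧ E₂ x = 0)
    (hEi : Integrable fun x => (1 + |x|) * derivNorm E E₁ E₂ x)
    (hBi : Integrable (derivNorm B B₁ B₂)) :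
    ∫ p : ℝ × ℝ, W p * adjointTest m E E₁ E₂ B B₂ p = 0 := by
  obtain ⟨e, e₁, e₂, C, hC, he, hez, hes, hee, heb⟩ := exists_compact_approx hE
  obtain ⟨b, b₁, b₂, D, hD, hb, -, hbs, hbe, hbb⟩ := exists_compact_approx hB
  have hM0 : 0 ≤ M := (norm_nonneg _).trans (hM 0)
  have hlim : Tendsto (fun n => ∫ p : ℝ × ℝ, W p * adjointTest m (e n) (e₁ n) (e₂ n) (b n) (b₂ n) p)
      atTop (𝓝 (∫ p : ℝ × ℝ, W p * adjointTest m E E₁ E₂ B B₂ p)) := by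
    refine tendsto_integral_of_dominated_convergence
      (fun p => M * (2 + ‖2 - m‖) * (C * D) *
        ((1 + |p.1|) * derivNorm E E₁ E₂ p.1 * derivNorm B B₁ B₂ p.2)) ?_ ?_ ?_ ?_
    · exact fun n => (hW.mul (continuous_adjointTest (he n) (hb n))).aestronglyMeasurable
    · exact (hEi.mul_prod hBi).const_mul _
    · refine fun n => Eventually.of_forall fun p => ?_
      obtain ⟨h0, h1, h2⟩ := heb n p.1
      obtain ⟨k0, -, k2⟩ := hbb n p.2
      rw [norm_mul]
      calc ‖W p‖ * _ ≤ M * _ :=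
            mul_le_mul (hM p) (norm_adjointTest_le h0 h1 h2 k0 k2) (norm_nonneg _) hM0
        _ = _ := by ring
    · refine Eventually.of_forall fun p => tendsto_const_nhds.congr' ?_
      filter_upwards [hee p.1, hbe p.2] with n hn hn'
      rw [adjointTest, adjointTest, hn.1, hn.2.1, hn.2.2, hn'.1, hn'.2.2]
  have hzero : ∀ n, ∫ p : ℝ × ℝ, W p * adjointTest m (e n) (e₁ n) (e₂ n) (b n) (b₂ n) p = 0 := by
    intro n
    have hn : (0 : ℝ) ≤ n := n.cast_nonneg
    -- The cutoffs are known to vanish only for `|x| > 2 (n + 1)`, strictly; the factor `3` leaves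
    -- room for the endpoints.
    refine integral_mul_adjointTest_of_compact hU (a := a) (b := a + 3 * (n + 1))
      (c := -(3 * ((n : ℝ) + 1))) (d := 3 * (n + 1)) ha (by linarith) (by linarith) (he n) (hb n)
      (fun x hx => ?_) (fun y hy => ?_)
    · rcases le_or_gt x a with h | h
      · exact hez n x (hEa x h).1 (hEa x h).2.1 (hEa x h).2.2
      · refine hes n x (lt_abs.2 (Or.inl ?_))
        have : a + 3 * ((n : ℝ) + 1) ≤ x := not_lt.1 fun h' => hx ⟨h, h'⟩
        linarith
    · refine hbs n y (lt_abs.2 ?_)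
      by_contra! hcon
      exact hy ⟨by linarith [hcon.2], by linarith [hcon.1]⟩
  simp only [hzero] at hlim
  exact tendsto_nhds_unique hlim tendsto_const_nhds

end

/-! ### Test functions reaching the boundary -/

section

variable {m : ℂ} {W : ℝ × ℝ → ℂ} {M K : ℝ} {G G₁ G₂ B B₁ B₂ : ℝ → ℝ}

theorem continuous_integral_snd (hW : Continuous W) (hM : ∀ p, ‖W p‖ ≤ M) (hBc : Continuous B)
    (hB : Integrable B) : Continuous fun x => ∫ y, W (x, y) * B y := by
  refine continuous_of_dominated (bound := fun y => M * ‖B y‖) ?_ ?_ (hB.norm.const_mul M) ?_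
  · exact fun x => (Continuous.mul (by fun_prop) (by fun_prop)).aestronglyMeasurable
  · refine fun x => Eventually.of_forall fun y => ?_
    rw [norm_mul, Complex.norm_real]
    gcongr
    exact hM _
  · exact Eventually.of_forall fun y => by fun_prop

/-- The commutator of the adjoint operator with the rescaled step `χ(c x)`, in the variable
`t = c x`. -/
def stepRemainder (m : ℂ) (G G₁ χ₁ χ₂ : ℝ → ℝ) (c t : ℝ) : ℂ :=
  (2 * c⁻¹ * t * χ₁ t * G₁ (c⁻¹ * t) + t * χ₂ t * G (c⁻¹ * t) : ℝ) +
    (2 - m) * (χ₁ t * G (c⁻¹ * t) : ℝ)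

theorem adjointTest_step (χ χ₁ χ₂ : ℝ → ℝ) {c : ℝ} (hc : 0 < c) (p : ℝ × ℝ) :
    adjointTest m (fun x => G x * χ (c * x)) (fun x => G₁ x * χ (c * x) + G x * (c * χ₁ (c * x)))
      (fun x => G₂ x * χ (c * x) + 2 * (G₁ x * (c * χ₁ (c * x))) + G x * (c ^ 2 * χ₂ (c * x)))
      B B₂ p = (χ (c * p.1) : ℂ) * adjointTest m G G₁ G₂ B B₂ p +
        (c * stepRemainder m G G₁ χ₁ χ₂ c (c * p.1)) * B p.2 := by
  have hc' : (c : ℂ) ≠ 0 := by exact_mod_cast hc.ne'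
  simp only [adjointTest, stepRemainder, inv_mul_cancel_left₀ hc.ne']
  push_cast
  field_simp
  ring

/-- The derivatives of the step live on `[1, 2]`, where `|t| ≤ 2` and `c⁻¹ ≤ 1`; the three terms
contribute `4CK`, `2CK` and `‖2 - m‖CK`. -/
theorem norm_stepRemainder_le {χ₁ χ₂ : ℝ → ℝ} {c C : ℝ} (hc : 1 ≤ c) (hG : ∀ x, |G x| ≤ K)
    (hG₁ : ∀ x, |G₁ x| ≤ K) (h1 : ∀ x, |χ₁ x| ≤ C) (h2 : ∀ x, |χ₂ x| ≤ C)
    (hl : ∀ x < 1, χ₁ x = 0 ∧ χ₂ x = 0) (hr : ∀ x > 2, χ₁ x = 0 ∧ χ₂ x = 0) (t : ℝ) :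
    ‖stepRemainder m G G₁ χ₁ χ₂ c t‖ ≤
      Set.indicator (Set.Icc 1 2) (fun _ => (6 + ‖2 - m‖) * C * K) t := by
  by_cases ht : t ∈ Set.Icc (1 : ℝ) 2
  · rw [Set.indicator_of_mem ht]
    have hC : 0 ≤ C := (abs_nonneg _).trans (h1 0)
    have hK : 0 ≤ K := (abs_nonneg _).trans (hG 0)
    have hci : c⁻¹ ≤ 1 := inv_le_one_of_one_le₀ hc
    have hci0 : 0 ≤ c⁻¹ := by positivity
    have ht0 : |t| ≤ 2 := by rw [abs_of_nonneg (by linarith [ht.1])]; exact ht.2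
    rw [stepRemainder]
    have e1 : |2 * c⁻¹ * t * χ₁ t * G₁ (c⁻¹ * t)| ≤ 2 * 1 * 2 * C * K := by
      simp only [abs_mul, abs_two, abs_of_nonneg hci0]
      gcongr
      · exact h1 t
      · exact hG₁ _
    have e2 : |t * χ₂ t * G (c⁻¹ * t)| ≤ 2 * C * K := by
      simp only [abs_mul]
      gcongr
      · exact h2 t
      · exact hG _
    have e3 : |χ₁ t * G (c⁻¹ * t)| ≤ C * K := by
      simp only [abs_mul]
      gcongr
      · exact h1 t
      · exact hG _
    refine (norm_add_le _ _).trans ?_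
    rw [norm_mul, Complex.norm_real, Complex.norm_real, Real.norm_eq_abs, Real.norm_eq_abs]
    have := mul_le_mul_of_nonneg_left e3 (norm_nonneg (2 - m))
    linarith [abs_add_le (2 * c⁻¹ * t * χ₁ t * G₁ (c⁻¹ * t)) (t * χ₂ t * G (c⁻¹ * t))]
  · rw [Set.indicator_of_notMem ht]
    have : χ₁ t = 0 ∧ χ₂ t = 0 := by
      rcases lt_or_ge t 1 with h | h
      · exact hl t h
      · exact hr t (not_le.1 fun h' => ht ⟨h, h'⟩)
    simp [stepRemainder, this]

theorem continuous_stepRemainder {χ₁ χ₂ : ℝ → ℝ} (h1 : Continuous χ₁) (h2 : Continuous χ₂)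
    (hG : Continuous G) (hG₁ : Continuous G₁) (c : ℝ) :
    Continuous (stepRemainder m G G₁ χ₁ χ₂ c) := by
  unfold stepRemainder
  fun_prop

/-- Insert the step `χ(c x)` with `c → ∞`. The commutator has size `c` but lives on a strip of width
`1 / c`; in the variable `t = c x` it is a bounded weight on `[1, 2]` paired with `Q(t / c)`, where
`Q(x) = ∫ W(x, y) B(y) dy`. Since `Q` is continuous with `Q(0) = 0`, no boundary term survives. -/
theorem integral_mul_adjointTest_eq_zero (hU : IsAxisymmetricPotential m W) (hW : Continuous W)
    (hM : ∀ p, ‖W p‖ ≤ M) (hW0 : ∀ p : ℝ × ℝ, p.1 ≤ 0 → W p = 0)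
    (hG : HasTwoDerivs G G₁ G₂) (hB : HasTwoDerivs B B₁ B₂)
    (hGi : Integrable fun x => (1 + |x|) * derivNorm G G₁ G₂ x)
    (hBi : Integrable (derivNorm B B₁ B₂)) (hK : ∀ x, |G x| ≤ K) (hK₁ : ∀ x, |G₁ x| ≤ K) :
    ∫ p : ℝ × ℝ, W p * adjointTest m G G₁ G₂ B B₂ p = 0 := by
  obtain ⟨χ, χ₁, χ₂, C, hχ, hl, hr, hC⟩ := exists_step
  have hC0 : 0 ≤ C := (abs_nonneg _).trans (hC 0).1
  have hM0 : 0 ≤ M := (norm_nonneg _).trans (hM 0)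
  set c : ℕ → ℝ := fun n => (n : ℝ) + 1 with hcdef
  have hc1 : ∀ n, 1 ≤ c n := fun n => by simp [hcdef]
  have hc0 : ∀ n, 0 < c n := fun n => one_pos.trans_le (hc1 n)
  have hctop : Tendsto c atTop atTop :=
    tendsto_atTop_add_const_right _ _ tendsto_natCast_atTop_atTop
  have hχc := hχ.cont_zero
  have hBint : Integrable B := hBi.mono' hB.cont_zero.aestronglyMeasurable
    (Eventually.of_forall fun y => by
      rw [derivNorm, Real.norm_eq_abs]; linarith [abs_nonneg (B₁ y), abs_nonneg (B₂ y)])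
  set Q : ℝ → ℂ := fun x => ∫ y, W (x, y) * B y with hQ
  have hQc : Continuous Q := continuous_integral_snd hW hM hB.cont_zero hBint
  have hQ0 : Q 0 = 0 := by
    simp only [hQ]
    refine (integral_congr_ae (Eventually.of_forall fun y => ?_)).trans (integral_zero _ _)
    simp [hW0 (0, y) le_rfl]
  have hQb : ∀ x, ‖Q x‖ ≤ M * ∫ y, ‖B y‖ := fun x => by
    rw [← integral_const_mul]
    refine norm_integral_le_of_norm_le (hBint.norm.const_mul M) (Eventually.of_forall fun y => ?_)
    rw [norm_mul, Complex.norm_real]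
    gcongr
    exact hM _
  have hGint := integrable_mul_adjointTest (m := m) hW hM hG hB hGi hBi
  have hχint : ∀ n, Integrable fun p : ℝ × ℝ =>
      (χ (c n * p.1) : ℂ) * (W p * adjointTest m G G₁ G₂ B B₂ p) := fun n =>
    hGint.bdd_mul (c := C) (Continuous.aestronglyMeasurable (by fun_prop))
      (Eventually.of_forall fun p => by simpa using (hC _).1)
  -- the truncated test functions
  have hEd : ∀ n, HasTwoDerivs (fun x => G x * χ (c n * x))
      (fun x => G₁ x * χ (c n * x) + G x * (c n * χ₁ (c n * x)))
      (fun x => G₂ x * χ (c n * x) + 2 * (G₁ x * (c n * χ₁ (c n * x))) +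
        G x * (c n ^ 2 * χ₂ (c n * x))) := fun n => hG.mul (hχ.comp_mul_left (c n))
  have hEi : ∀ n, Integrable fun x => (1 + |x|) * derivNorm (fun x => G x * χ (c n * x))
      (fun x => G₁ x * χ (c n * x) + G x * (c n * χ₁ (c n * x)))
      (fun x => G₂ x * χ (c n * x) + 2 * (G₁ x * (c n * χ₁ (c n * x))) +
        G x * (c n ^ 2 * χ₂ (c n * x))) x := fun n => by
    refine (hGi.const_mul (3 * (2 * (C * (1 + c n) ^ 2)))).mono' ?_
      (Eventually.of_forall fun x => ?_)
    · have h1 := (hEd n).cont_zero; have h2 := (hEd n).cont_fst; have h3 := (hEd n).cont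
      unfold derivNorm
      exact Continuous.aestronglyMeasurable (by fun_prop)
    · obtain ⟨b0, b1, b2⟩ := hC (c n * x)
      obtain ⟨b0, b1, b2⟩ := abs_scaled_derivs_le (hc0 n).le b0 b1 b2
      obtain ⟨d0, d1, d2⟩ := abs_mul_derivs_le (f := G x) (f₁ := G₁ x) (f₂ := G₂ x) b0 b1 b2
      rw [Real.norm_eq_abs, abs_of_nonneg (mul_nonneg (by positivity) (derivNorm_nonneg _ _ _ _)),
        mul_left_comm]
      refine mul_le_mul_of_nonneg_left ?_ (by positivity)
      simp only [derivNorm]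
      linarith
  have hzero : ∀ n, ∫ p : ℝ × ℝ, ((χ (c n * p.1) : ℂ) * (W p * adjointTest m G G₁ G₂ B B₂ p) +
      W p * ((c n * stepRemainder m G G₁ χ₁ χ₂ (c n) (c n * p.1)) * B p.2)) = 0 := fun n => by
    -- For `x ≤ 1 / (2c)` one has `c x ≤ 1/2 < 1`, where the step and its derivatives vanish.
    have h := integral_mul_adjointTest_of_pos hU hW hM (hEd n) hB (a := (2 * c n)⁻¹)
      (by have := hc0 n; positivity) (fun x hx => ?_) (hEi n) hBi
    · rw [← h]
      congr 1 with p
      rw [adjointTest_step χ χ₁ χ₂ (hc0 n)]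
      ring
    · have : c n * x < 1 := by
        have h' := mul_le_mul_of_nonneg_left hx (hc0 n).le
        rw [mul_inv, mul_left_comm, mul_inv_cancel₀ (hc0 n).ne'] at h'
        linarith
      obtain ⟨z0, z1, z2⟩ := hl _ this
      simp [z0, z1, z2]
  have hRint : ∀ n, Integrable fun p : ℝ × ℝ =>
      W p * ((c n * stepRemainder m G G₁ χ₁ χ₂ (c n) (c n * p.1)) * B p.2) := fun n => by
    have h1 := integrable_mul_adjointTest (m := m) hW hM (hEd n) hB (hEi n) hBi
    refine (h1.sub (hχint n)).congr (Eventually.of_forall fun p => ?_)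
    simp only [Pi.sub_apply]
    rw [adjointTest_step χ χ₁ χ₂ (hc0 n)]
    ring
  -- Fubini, then `t = c x`, whose Jacobian absorbs the factor `c`.
  have hR : ∀ n, ∫ p : ℝ × ℝ,
      W p * ((c n * stepRemainder m G G₁ χ₁ χ₂ (c n) (c n * p.1)) * B p.2) =
      ∫ t, stepRemainder m G G₁ χ₁ χ₂ (c n) t * Q ((c n)⁻¹ * t) := fun n => by
    have e1 : ∀ x : ℝ, (∫ y, W (x, y) *
        ((c n * stepRemainder m G G₁ χ₁ χ₂ (c n) (c n * x)) * B y)) =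
        c n * (stepRemainder m G G₁ χ₁ χ₂ (c n) (c n * x) * Q ((c n)⁻¹ * (c n * x))) := fun x => by
      rw [inv_mul_cancel_left₀ (hc0 n).ne', ← mul_assoc, ← integral_const_mul]
      congr 1 with y
      ring
    rw [Measure.volume_eq_prod, integral_prod _ (hRint n)]
    simp only [e1]
    rw [integral_const_mul, Measure.integral_comp_mul_left
      (fun t => stepRemainder m G G₁ χ₁ χ₂ (c n) t * Q ((c n)⁻¹ * t)) (c n),
      abs_of_pos (inv_pos.2 (hc0 n)), Complex.real_smul, Complex.ofReal_inv,
      mul_inv_cancel_left₀ (by exact_mod_cast (hc0 n).ne')]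
  -- For `x > 0` the step is eventually `1`; for `x ≤ 0` the factor `W` vanishes.
  have hlim1 : Tendsto (fun n => ∫ p : ℝ × ℝ,
      (χ (c n * p.1) : ℂ) * (W p * adjointTest m G G₁ G₂ B B₂ p)) atTop
      (𝓝 (∫ p : ℝ × ℝ, W p * adjointTest m G G₁ G₂ B B₂ p)) := by
    refine tendsto_integral_of_dominated_convergence
      (fun p => C * ‖W p * adjointTest m G G₁ G₂ B B₂ p‖) (fun n => (hχint n).aestronglyMeasurable)
      (hGint.norm.const_mul C) (fun n => Eventually.of_forall fun p => ?_)
      (Eventually.of_forall fun p => ?_)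
    · rw [norm_mul, Complex.norm_real]
      gcongr
      exact (hC _).1
    · refine tendsto_const_nhds.congr' ?_
      rcases le_or_gt p.1 0 with hp | hp
      · simp [hW0 p hp]
      · filter_upwards [(hctop.atTop_mul_const hp).eventually_gt_atTop 2] with n hn
        simp [(hr _ hn).1]
  have hbd : ∀ n t, ‖stepRemainder m G G₁ χ₁ χ₂ (c n) t‖ ≤
      Set.indicator (Set.Icc 1 2) (fun _ => (6 + ‖2 - m‖) * C * K) t := fun n =>
    norm_stepRemainder_le (hc1 n) hK hK₁ (fun x => (hC x).2.1) (fun x => (hC x).2.2)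
      (fun x hx => (hl x hx).2) (fun x hx => (hr x hx).2)
  have hlim2 : Tendsto (fun n => ∫ t, stepRemainder m G G₁ χ₁ χ₂ (c n) t * Q ((c n)⁻¹ * t)) atTop
      (𝓝 (∫ _ : ℝ, (0 : ℂ))) := by
    refine tendsto_integral_of_dominated_convergence
      (fun t => Set.indicator (Set.Icc 1 2) (fun _ => (6 + ‖2 - m‖) * C * K) t *
        (M * ∫ y, ‖B y‖)) (fun n => ?_) ?_ (fun n => Eventually.of_forall fun t => ?_)
      (Eventually.of_forall fun t => ?_)
    · have := continuous_stepRemainder (m := m) hχ.cont_fst hχ.cont hG.cont_zero hG.cont_fst (c n)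
      exact Continuous.aestronglyMeasurable (by fun_prop)
    · exact ((integrable_indicator_iff measurableSet_Icc).2
        (integrableOn_const (by simp))).mul_const _
    · rw [norm_mul]
      exact mul_le_mul (hbd n t) (hQb _) (norm_nonneg _) ((norm_nonneg _).trans (hbd n t))
    · have hQt : Tendsto (fun n => Q ((c n)⁻¹ * t)) atTop (𝓝 0) := by
        have h1 : Tendsto (fun n => (c n)⁻¹ * t) atTop (𝓝 (0 * t)) :=
          (tendsto_inv_atTop_zero.comp hctop).mul_const t
        have h2 := (hQc.tendsto (0 * t)).comp h1
        rwa [zero_mul, hQ0] at h2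
      have hQt' := hQt.norm.const_mul
        (Set.indicator (Set.Icc 1 2) (fun _ => (6 + ‖2 - m‖) * C * K) t)
      rw [norm_zero, mul_zero] at hQt'
      refine squeeze_zero_norm (fun n => ?_) hQt'
      rw [norm_mul]
      exact mul_le_mul_of_nonneg_right (hbd n t) (norm_nonneg _)
  rw [integral_zero] at hlim2
  have hsum := hlim1.add hlim2
  rw [add_zero] at hsum
  refine tendsto_nhds_unique hsum (tendsto_const_nhds.congr fun n => ?_)
  rw [← hR n, ← integral_add (hχint n) (hRint n), hzero n]

end

/-! ### Gaussian moments -/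

theorem hasTwoDerivs_gaussian (l b : ℝ) :
    HasTwoDerivs (fun x => Real.exp (-l * (x - b) ^ 2))
      (fun x => -(2 * l * (x - b)) * Real.exp (-l * (x - b) ^ 2))
      (fun x => (4 * l ^ 2 * (x - b) ^ 2 - 2 * l) * Real.exp (-l * (x - b) ^ 2)) := by
  have h1 : ∀ x : ℝ, HasDerivAt (fun x => x - b) 1 x := fun x => (hasDerivAt_id x).sub_const b
  have h2 : ∀ x : ℝ, HasDerivAt (fun x => Real.exp (-l * (x - b) ^ 2))
      (-(2 * l * (x - b)) * Real.exp (-l * (x - b) ^ 2)) x := fun x => by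
    refine ((((h1 x).pow 2).const_mul (-l)).exp).congr_deriv ?_
    simp only [Pi.pow_apply]
    ring
  refine ⟨h2, fun x => ?_, by fun_prop⟩
  refine ((((h1 x).const_mul (2 * l)).neg).mul (h2 x)).congr_deriv ?_
  simp only [Pi.neg_apply]
  ring

theorem integrable_abs_pow_mul_gaussian {l : ℝ} (hl : 0 < l) (k : ℕ) :
    Integrable fun x : ℝ => |x| ^ k * Real.exp (-l * x ^ 2) := by
  have h := (integrable_rpow_mul_exp_neg_mul_sq hl (s := k)
    (by linarith [k.cast_nonneg (α := ℝ)])).norm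
  refine h.congr (Eventually.of_forall fun x => ?_)
  simp

theorem integrable_mul_derivNorm_gaussian {l : ℝ} (hl : 0 < l) :
    Integrable fun x => (1 + |x|) * derivNorm (fun x => Real.exp (-l * (x - 0) ^ 2))
      (fun x => -(2 * l * (x - 0)) * Real.exp (-l * (x - 0) ^ 2))
      (fun x => (4 * l ^ 2 * (x - 0) ^ 2 - 2 * l) * Real.exp (-l * (x - 0) ^ 2)) x := by
  have i := fun k => integrable_abs_pow_mul_gaussian hl k
  have hd := hasTwoDerivs_gaussian l 0
  refine (((((i 0).const_mul (1 + 2 * l)).add ((i 1).const_mul (1 + 4 * l))).add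
    ((i 2).const_mul (2 * l + 4 * l ^ 2))).add ((i 3).const_mul (4 * l ^ 2))).mono' ?_
    (Eventually.of_forall fun x => ?_)
  · have h1 := hd.cont_zero; have h2 := hd.cont_fst; have h3 := hd.cont
    unfold derivNorm
    exact Continuous.aestronglyMeasurable (by fun_prop)
  · rw [Real.norm_eq_abs, abs_of_nonneg (mul_nonneg (by positivity) (derivNorm_nonneg _ _ _ _))]
    simp only [derivNorm, Pi.add_apply, sub_zero, abs_mul, Real.abs_exp, abs_neg, abs_two,
      abs_of_pos hl]
    have h4 : |4 * l ^ 2 * x ^ 2 - 2 * l| ≤ 4 * l ^ 2 * |x| ^ 2 + 2 * l := by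
      rw [sq_abs, abs_le]
      constructor <;> nlinarith [sq_nonneg (l * x)]
    calc _ ≤ (1 + |x|) * (Real.exp (-l * x ^ 2) + 2 * l * |x| * Real.exp (-l * x ^ 2) +
          (4 * l ^ 2 * |x| ^ 2 + 2 * l) * Real.exp (-l * x ^ 2)) := by gcongr
      _ = _ := by ring

theorem integrable_derivNorm_gaussian {l : ℝ} (hl : 0 < l) (b : ℝ) :
    Integrable (derivNorm (fun x => Real.exp (-l * (x - b) ^ 2))
      (fun x => -(2 * l * (x - b)) * Real.exp (-l * (x - b) ^ 2))
      (fun x => (4 * l ^ 2 * (x - b) ^ 2 - 2 * l) * Real.exp (-l * (x - b) ^ 2))) := by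
  have h0 := (integrable_mul_derivNorm_gaussian hl)
  have h := h0.comp_sub_right b
  have hd := hasTwoDerivs_gaussian l b
  refine h.mono' ?_ (Eventually.of_forall fun x => ?_)
  · have h1 := hd.cont_zero; have h2 := hd.cont_fst; have h3 := hd.cont
    unfold derivNorm
    exact Continuous.aestronglyMeasurable (by fun_prop)
  · rw [Real.norm_eq_abs, abs_of_nonneg (derivNorm_nonneg _ _ _ _)]
    simp only [derivNorm, sub_zero]
    refine le_mul_of_one_le_left (by positivity) (by linarith [abs_nonneg (x - b)])

theorem abs_gaussian_deriv_le {l : ℝ} (hl : 0 < l) (x : ℝ) :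
    |Real.exp (-l * (x - 0) ^ 2)| ≤ 1 + l ∧
      |-(2 * l * (x - 0)) * Real.exp (-l * (x - 0) ^ 2)| ≤ 1 + l := by
  have h1 : Real.exp (-l * (x - 0) ^ 2) ≤ 1 := Real.exp_le_one_iff.2 (by nlinarith [sq_nonneg x])
  rw [Real.abs_exp]
  refine ⟨by linarith, ?_⟩
  rw [abs_mul, Real.abs_exp, abs_neg, abs_mul, abs_mul, abs_two, abs_of_pos hl, sub_zero,
    neg_mul, Real.exp_neg, ← div_eq_mul_inv, div_le_iff₀ (Real.exp_pos _)]
  -- The chain is `2l|x| ≤ l (1 + x²) ≤ (1 + l)(1 + l x²) ≤ (1 + l) exp(l x²)`.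
  have h2 := Real.add_one_le_exp (l * x ^ 2)
  have h3 : 2 * l * |x| ≤ l * (1 + x ^ 2) := by nlinarith [sq_nonneg (|x| - 1), sq_abs x]
  nlinarith [mul_nonneg hl.le (sq_nonneg x), mul_nonneg hl.le (mul_nonneg hl.le (sq_nonneg x))]

/-- The Gaussian moment `∫∫ W(x, y) x exp(-l (x² + (y - b)²)) dx dy`. -/
def gaussianMoment (W : ℝ × ℝ → ℂ) (b l : ℝ) : ℂ :=
  ∫ p : ℝ × ℝ, W p * (p.1 * Real.exp (-l * (p.1 ^ 2 + (p.2 - b) ^ 2)) : ℝ)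

section

variable {m : ℂ} {W : ℝ × ℝ → ℂ} {M : ℝ}

/-- With `r² = x² + (y - b)²`, the adjoint multiplies `x exp(-l r²)` by `4l² r² - (8 - 2m) l`. The
factor `-r²` is kept together because it is what `∂/∂l` produces, so orthogonality becomes an
equation in `l`. -/
theorem adjointTest_gaussian (l b : ℝ) (p : ℝ × ℝ) :
    adjointTest m (fun x => Real.exp (-l * (x - 0) ^ 2))
      (fun x => -(2 * l * (x - 0)) * Real.exp (-l * (x - 0) ^ 2))
      (fun x => (4 * l ^ 2 * (x - 0) ^ 2 - 2 * l) * Real.exp (-l * (x - 0) ^ 2))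
      (fun x => Real.exp (-l * (x - b) ^ 2))
      (fun x => (4 * l ^ 2 * (x - b) ^ 2 - 2 * l) * Real.exp (-l * (x - b) ^ 2)) p =
    -(4 * l ^ 2) * (-(p.1 * (p.1 ^ 2 + (p.2 - b) ^ 2) *
        Real.exp (-l * (p.1 ^ 2 + (p.2 - b) ^ 2))) : ℝ) -
      (8 - 2 * m) * l * (p.1 * Real.exp (-l * (p.1 ^ 2 + (p.2 - b) ^ 2)) : ℝ) := by
  rw [adjointTest, mul_add (-l), Real.exp_add]
  push_cast
  simp only [sub_zero]
  ring

theorem integrable_sq_weighted_gaussian {l : ℝ} (hl : 0 < l) (b : ℝ) :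
    Integrable fun p : ℝ × ℝ => |p.1| * (p.1 ^ 2 + (p.2 - b) ^ 2) *
      Real.exp (-l * (p.1 ^ 2 + (p.2 - b) ^ 2)) := by
  have i := fun k => integrable_abs_pow_mul_gaussian hl k
  have h := ((i 3).mul_prod ((i 0).comp_sub_right b)).add ((i 1).mul_prod ((i 2).comp_sub_right b))
  refine h.congr (Eventually.of_forall fun p => ?_)
  simp only [Pi.add_apply, mul_add (-l), Real.exp_add, sq_abs, pow_one, pow_zero, one_mul]
  rw [show |p.1| ^ 3 = |p.1| * p.1 ^ 2 by rw [← sq_abs p.1]; ring]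
  ring

theorem integrable_weighted_gaussian {l : ℝ} (hl : 0 < l) (b : ℝ) :
    Integrable fun p : ℝ × ℝ => |p.1| * Real.exp (-l * (p.1 ^ 2 + (p.2 - b) ^ 2)) := by
  have i := fun k => integrable_abs_pow_mul_gaussian hl k
  refine ((i 1).mul_prod ((i 0).comp_sub_right b)).congr (Eventually.of_forall fun p => ?_)
  simp only [mul_add (-l), Real.exp_add, pow_one, pow_zero, one_mul]
  ring

theorem integrable_mul_gaussian (hW : Continuous W) (hM : ∀ p, ‖W p‖ ≤ M) {l : ℝ} (hl : 0 < l)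
    (b : ℝ) : Integrable fun p : ℝ × ℝ =>
      W p * (p.1 * Real.exp (-l * (p.1 ^ 2 + (p.2 - b) ^ 2)) : ℝ) := by
  refine ((integrable_weighted_gaussian hl b).const_mul M).mono'
    (Continuous.aestronglyMeasurable (by fun_prop)) (Eventually.of_forall fun p => ?_)
  rw [norm_mul, Complex.norm_real, Real.norm_eq_abs, abs_mul, Real.abs_exp]
  gcongr
  exact hM p

theorem hasDerivAt_gaussianMoment (hW : Continuous W) (hM : ∀ p, ‖W p‖ ≤ M) {l : ℝ} (hl : 0 < l)
    (b : ℝ) :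
    Integrable (fun p : ℝ × ℝ => W p * (-(p.1 * (p.1 ^ 2 + (p.2 - b) ^ 2) *
        Real.exp (-l * (p.1 ^ 2 + (p.2 - b) ^ 2))) : ℝ)) ∧
    HasDerivAt (gaussianMoment W b) (∫ p : ℝ × ℝ, W p * (-(p.1 * (p.1 ^ 2 + (p.2 - b) ^ 2) *
        Real.exp (-l * (p.1 ^ 2 + (p.2 - b) ^ 2))) : ℝ)) l := by
  have hM0 : 0 ≤ M := (norm_nonneg _).trans (hM 0)
  refine hasDerivAt_integral_of_dominated_loc_of_deriv_le (𝕜 := ℝ)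
    (F := fun (l : ℝ) (p : ℝ × ℝ) => W p * (p.1 * Real.exp (-l * (p.1 ^ 2 + (p.2 - b) ^ 2)) : ℝ))
    (F' := fun (l : ℝ) (p : ℝ × ℝ) => W p * (-(p.1 * (p.1 ^ 2 + (p.2 - b) ^ 2) *
        Real.exp (-l * (p.1 ^ 2 + (p.2 - b) ^ 2))) : ℝ))
    -- For parameters above `l / 2` every Gaussian is dominated by the one with parameter `l / 2`.
    (bound := fun p => M * (|p.1| * (p.1 ^ 2 + (p.2 - b) ^ 2) *
      Real.exp (-(l / 2) * (p.1 ^ 2 + (p.2 - b) ^ 2))))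
    (Ioi_mem_nhds (half_lt_self hl)) ?_ (integrable_mul_gaussian hW hM hl b) ?_ ?_
    ((integrable_sq_weighted_gaussian (half_pos hl) b).const_mul M) ?_
  · exact Eventually.of_forall fun l => Continuous.aestronglyMeasurable (by fun_prop)
  · exact Continuous.aestronglyMeasurable (by fun_prop)
  · refine Eventually.of_forall fun p t ht => ?_
    have hr : 0 ≤ p.1 ^ 2 + (p.2 - b) ^ 2 := by positivity
    rw [norm_mul, Complex.norm_real, Real.norm_eq_abs, abs_neg, abs_mul, abs_mul, Real.abs_exp,
      abs_of_nonneg hr]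
    gcongr
    · exact hM p
    · exact le_of_lt ht
  · refine Eventually.of_forall fun p t _ => ?_
    have h1 : HasDerivAt (fun t : ℝ => p.1 * Real.exp (-t * (p.1 ^ 2 + (p.2 - b) ^ 2)))
        (-(p.1 * (p.1 ^ 2 + (p.2 - b) ^ 2) *
          Real.exp (-t * (p.1 ^ 2 + (p.2 - b) ^ 2)))) t := by
      refine ((((hasDerivAt_id t).neg.mul_const (p.1 ^ 2 + (p.2 - b) ^ 2)).exp).const_mul
        p.1).congr_deriv ?_
      simp only [Pi.neg_apply, id]
      ring
    exact h1.ofReal_comp.const_mul (W p)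

/-- By scaling, the weighted `x`-integral contributes `l⁻¹` and the `y`-integral `l^(-1/2)`: the
bound is of order `l^(-3/2)`. -/
theorem norm_gaussianMoment_le (hM : ∀ p, ‖W p‖ ≤ M) {l : ℝ} (hl : 0 < l) (b : ℝ) :
    ‖gaussianMoment W b l‖ ≤
      M * (l⁻¹ * (∫ x : ℝ, |x| * Real.exp (-x ^ 2)) * √(Real.pi / l)) := by
  have e1 : ∫ x : ℝ, |x| * Real.exp (-l * x ^ 2) = l⁻¹ * ∫ x : ℝ, |x| * Real.exp (-x ^ 2) := by
    have hs : 0 < √l := Real.sqrt_pos.2 hl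
    have h := Measure.integral_comp_mul_left (fun x : ℝ => |x| * Real.exp (-x ^ 2)) (√l)
    simp only [mul_pow, Real.sq_sqrt hl.le, abs_mul, abs_of_pos hs, mul_assoc, smul_eq_mul] at h
    rw [integral_const_mul, abs_of_pos (inv_pos.2 hs)] at h
    simp only [neg_mul]
    rw [eq_inv_mul_iff_mul_eq₀ hl.ne']
    nth_rewrite 1 [← Real.mul_self_sqrt hl.le]
    rw [mul_assoc, h, mul_inv_cancel_left₀ hs.ne']
  have e2 : ∫ p : ℝ × ℝ, |p.1| * Real.exp (-l * (p.1 ^ 2 + (p.2 - b) ^ 2)) =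
      l⁻¹ * (∫ x : ℝ, |x| * Real.exp (-x ^ 2)) * √(Real.pi / l) := by
    rw [← e1, ← integral_gaussian,
      ← integral_sub_right_eq_self (fun y => Real.exp (-l * y ^ 2)) b, Measure.volume_eq_prod,
      ← integral_prod_mul]
    congr 1 with p
    rw [mul_add (-l), Real.exp_add]
    ring
  rw [← e2, ← integral_const_mul]
  refine norm_integral_le_of_norm_le ((integrable_weighted_gaussian hl b).const_mul M)
    (Eventually.of_forall fun p => ?_)
  rw [norm_mul, Complex.norm_real, Real.norm_eq_abs, abs_mul, Real.abs_exp]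
  gcongr
  exact hM p

/-- Orthogonality gives `F' = -(q / l) F` with `q = 2 - m/2`, so `l^q F(l)` is constant. It is
bounded by a multiple of `l^(Re q - 3/2)`, and `Re q - 3/2 = (1 - Re m) / 2 > 0`, so the constant is
`0`. In the uniqueness argument for zero data, `Re m < 1` enters only here. -/
theorem gaussianMoment_eq_zero (hm : m.re < 1) (hU : IsAxisymmetricPotential m W)
    (hW : Continuous W) (hM : ∀ p, ‖W p‖ ≤ M) (hW0 : ∀ p : ℝ × ℝ, p.1 ≤ 0 → W p = 0) (b : ℝ)
    {l : ℝ} (hl : 0 < l) : gaussianMoment W b l = 0 := by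
  have hM0 : 0 ≤ M := (norm_nonneg _).trans (hM 0)
  have hode : ∀ l : ℝ, 0 < l → HasDerivAt (gaussianMoment W b)
      (-((2 - m / 2) / l * gaussianMoment W b l)) l := fun l hl => by
    obtain ⟨hi, hd⟩ := hasDerivAt_gaussianMoment hW hM hl b
    refine hd.congr_deriv ?_
    have h := integral_mul_adjointTest_eq_zero hU hW hM hW0 (hasTwoDerivs_gaussian l 0)
      (hasTwoDerivs_gaussian l b) (integrable_mul_derivNorm_gaussian hl)
      (integrable_derivNorm_gaussian hl b) (fun x => (abs_gaussian_deriv_le hl x).1)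
      (fun x => (abs_gaussian_deriv_le hl x).2)
    simp only [adjointTest_gaussian] at h
    simp only [mul_sub (W _), mul_left_comm (W _)] at h
    rw [integral_sub (hi.const_mul _) ((integrable_mul_gaussian hW hM hl b).const_mul _),
      integral_const_mul, integral_const_mul] at h
    have hl' : (l : ℂ) ≠ 0 := by exact_mod_cast hl.ne'
    rw [← gaussianMoment] at h
    generalize (∫ p : ℝ × ℝ, W p * (-(p.1 * (p.1 ^ 2 + (p.2 - b) ^ 2) *
        Real.exp (-l * (p.1 ^ 2 + (p.2 - b) ^ 2))) : ℝ)) = I at h ⊢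
    have h4 : (4 * l : ℂ) ≠ 0 := mul_ne_zero (by norm_num) hl'
    have h5 : l * I = -(2 - m / 2) * gaussianMoment W b l := by
      apply mul_left_cancel₀ h4
      linear_combination -h
    rw [← mul_div_cancel_left₀ I hl', h5]
    ring
  set q : ℂ := 2 - m / 2 with hq
  have hqre : q.re = 2 - m.re / 2 := by
    rw [hq, show m / 2 = m / ((2 : ℝ) : ℂ) by push_cast; rfl, Complex.sub_re,
      Complex.div_ofReal_re]
    rfl
  -- This is `l^q F(l)` at `l = exp t`, so that `l → 0` becomes `t → -∞`.
  set k : ℝ → ℂ := fun t => Complex.exp (q * t) * gaussianMoment W b (Real.exp t) with hk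
  have hk' : ∀ t, HasDerivAt k 0 t := fun t => by
    have h1 : HasDerivAt (fun t : ℝ => Complex.exp (q * t)) (Complex.exp (q * t) * q) t := by
      have := ((hasDerivAt_id (t : ℂ)).const_mul q).cexp.comp_ofReal
      simpa using this
    have h2 := (hode _ (Real.exp_pos t)).scomp t (Real.hasDerivAt_exp t)
    refine (h1.mul h2).congr_deriv ?_
    have he : (Real.exp t : ℂ) ≠ 0 := by exact_mod_cast (Real.exp_pos t).ne'
    simp only [Function.comp, Complex.real_smul]
    field_simp
    ring
  have hconst : ∀ s t, k s = k t := is_const_of_deriv_eq_zero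
    (fun t => (hk' t).differentiableAt) fun t => (hk' t).deriv
  set A := M * ((∫ x : ℝ, |x| * Real.exp (-x ^ 2)) * √Real.pi) with hA
  have hbound : ∀ t, ‖k t‖ ≤ A * Real.exp ((q.re - 3 / 2) * t) := fun t => by
    rw [hk, norm_mul, Complex.norm_exp]
    have h1 := norm_gaussianMoment_le hM (Real.exp_pos t) b
    have h2 : (q * t : ℂ).re = q.re * t := by simp
    rw [h2]
    calc Real.exp (q.re * t) * ‖gaussianMoment W b (Real.exp t)‖
        ≤ Real.exp (q.re * t) * (M * ((Real.exp t)⁻¹ * (∫ x : ℝ, |x| * Real.exp (-x ^ 2)) *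
            √(Real.pi / Real.exp t))) := by gcongr
      _ = A * Real.exp ((q.re - 3 / 2) * t) := by
        rw [Real.sqrt_div Real.pi_pos.le, show √(Real.exp t) = Real.exp (t / 2) by
          rw [Real.exp_half], show (q.re - 3 / 2) * t = q.re * t + (-t + -(t / 2)) by ring,
          Real.exp_add, Real.exp_add, Real.exp_neg, Real.exp_neg, hA]
        field_simp
  have hlim : Tendsto (fun t : ℝ => A * Real.exp ((q.re - 3 / 2) * t)) atBot (𝓝 (A * 0)) := by
    refine (Real.tendsto_exp_atBot.comp ?_).const_mul A
    exact tendsto_id.const_mul_atBot (by rw [hqre]; linarith)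
  rw [mul_zero] at hlim
  have hk0 : k (Real.log l) = 0 := by
    have h1 : Tendsto k atBot (𝓝 0) := squeeze_zero_norm hbound hlim
    have h2 : Tendsto k atBot (𝓝 (k (Real.log l))) :=
      tendsto_const_nhds.congr fun t => hconst _ t
    exact tendsto_nhds_unique h2 h1
  simpa [hk, Real.exp_log hl, Complex.exp_ne_zero] using hk0

end

/-! ### A point-separating algebra of Gaussians -/

/-- A bounded continuous injective function on `ℝ` that equals `exp (-x²)` for `x ≥ 0`. -/
def gaussianCoord (x : ℝ) : ℝ := Real.exp (-(max x 0) ^ 2) + (1 - Real.exp (-(min x 0) ^ 2))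

theorem gaussianCoord_of_nonneg {x : ℝ} (hx : 0 ≤ x) : gaussianCoord x = Real.exp (-x ^ 2) := by
  simp [gaussianCoord, hx]

theorem continuous_gaussianCoord : Continuous gaussianCoord := by
  unfold gaussianCoord; fun_prop

theorem gaussianCoord_nonneg (x : ℝ) : 0 ≤ gaussianCoord x := by
  have : Real.exp (-(min x 0) ^ 2) ≤ 1 := Real.exp_le_one_iff.2 (neg_nonpos.2 (sq_nonneg _))
  have := Real.exp_pos (-(max x 0) ^ 2)
  rw [gaussianCoord]; linarith

theorem gaussianCoord_le_two (x : ℝ) : gaussianCoord x ≤ 2 := by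
  have : Real.exp (-(max x 0) ^ 2) ≤ 1 := Real.exp_le_one_iff.2 (neg_nonpos.2 (sq_nonneg _))
  have := Real.exp_pos (-(min x 0) ^ 2)
  rw [gaussianCoord]; linarith

theorem strictAnti_gaussianCoord : StrictAnti gaussianCoord := by
  intro x y hxy
  have h1 : Real.exp (-(max y 0) ^ 2) ≤ Real.exp (-(max x 0) ^ 2) := by
    gcongr
  have h2 : Real.exp (-(min x 0) ^ 2) ≤ Real.exp (-(min y 0) ^ 2) := by
    have := min_le_min_right 0 hxy.le
    exact Real.exp_le_exp.2 (by nlinarith [min_le_right x 0, min_le_right y 0])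
  rcases lt_or_ge 0 y with hy | hy
  · have : Real.exp (-(max y 0) ^ 2) < Real.exp (-(max x 0) ^ 2) := by
      rw [Real.exp_lt_exp, max_eq_left hy.le]
      have : max x 0 < y := max_lt hxy hy
      nlinarith [le_max_right x 0]
    rw [gaussianCoord, gaussianCoord]; linarith
  · have : Real.exp (-(min x 0) ^ 2) < Real.exp (-(min y 0) ^ 2) := by
      rw [Real.exp_lt_exp, min_eq_left hy, min_eq_left (hxy.le.trans hy)]
      nlinarith
    rw [gaussianCoord, gaussianCoord]; linarith

open BoundedContinuousFunction in
/-- The functions `exp (-k (x² + y²) + c y)`, modified for `x < 0` so as to separate points. -/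
def gaussianSubmonoid : Submonoid ((ℝ × ℝ) →ᵇ ℝ) where
  carrier := {f | ∃ (k : ℕ) (c : ℝ), (k = 0 → c = 0) ∧
    ∀ p, f p = gaussianCoord p.1 ^ k * Real.exp (-k * p.2 ^ 2 + c * p.2)}
  one_mem' := ⟨0, 0, fun _ => rfl, fun p => by simp⟩
  mul_mem' := by
    rintro f g ⟨k, c, hk, hf⟩ ⟨l, d, hl, hg⟩
    refine ⟨k + l, c + d, fun h => ?_, fun p => ?_⟩
    · rw [hk (by omega), hl (by omega), add_zero]
    · rw [BoundedContinuousFunction.mul_apply, hf, hg, mul_mul_mul_comm, ← pow_add, ← Real.exp_add]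
      push_cast
      ring_nf

open BoundedContinuousFunction in
theorem exists_mem_gaussianSubmonoid (c : ℝ) : ∃ f ∈ gaussianSubmonoid,
    ∀ p, f p = gaussianCoord p.1 * Real.exp (-p.2 ^ 2 + c * p.2) := by
  have hcont : Continuous fun p : ℝ × ℝ => gaussianCoord p.1 * Real.exp (-p.2 ^ 2 + c * p.2) := by
    have := continuous_gaussianCoord
    fun_prop
  refine ⟨BoundedContinuousFunction.ofNormedAddCommGroup _ hcont (2 * Real.exp (c ^ 2))
    fun p => ?_, ⟨1, c, by simp, fun p => by simp⟩, fun p => rfl⟩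
  rw [norm_mul, Real.norm_eq_abs, Real.norm_eq_abs, Real.abs_exp,
    abs_of_nonneg (gaussianCoord_nonneg _)]
  gcongr
  · exact gaussianCoord_le_two _
  · nlinarith [sq_nonneg (p.2 - c / 2), sq_nonneg c]

open BoundedContinuousFunction in
/-- The algebra generated by `gaussianSubmonoid`. -/
def gaussianAlgebra : StarSubalgebra ℝ ((ℝ × ℝ) →ᵇ ℝ) where
  toSubalgebra := Algebra.adjoin ℝ gaussianSubmonoid
  star_mem' := fun {f} hf => by
    have : star f = f := by ext; simp
    rwa [this]

open BoundedContinuousFunction in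
-- Dividing the values at `c = 1` by those at `c = 0` recovers `exp y`, hence `y`; the remaining
-- factor is injective in `x`.
theorem separatesPoints_gaussianAlgebra :
    (gaussianAlgebra.map (toContinuousMapStarₐ ℝ)).SeparatesPoints := by
  intro p p' hne
  by_contra! hcon
  have key : ∀ c : ℝ, gaussianCoord p.1 * Real.exp (-p.2 ^ 2 + c * p.2) =
      gaussianCoord p'.1 * Real.exp (-p'.2 ^ 2 + c * p'.2) := fun c => by
    obtain ⟨f, hf, hfp⟩ := exists_mem_gaussianSubmonoid c
    rw [← hfp, ← hfp]
    exact hcon f ⟨f.toContinuousMap, ⟨f, Algebra.subset_adjoin hf, rfl⟩, rfl⟩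
  have hpos : 0 < gaussianCoord p'.1 ∨ 0 < gaussianCoord p.1 := by
    by_contra! h
    have h1 : gaussianCoord p.1 = 0 := le_antisymm h.2 (gaussianCoord_nonneg _)
    have h2 : gaussianCoord p'.1 = 0 := le_antisymm h.1 (gaussianCoord_nonneg _)
    have h3 := strictAnti_gaussianCoord (show p.1 < p.1 + 1 by linarith)
    linarith [gaussianCoord_nonneg (p.1 + 1)]
  have h0 := key 0
  have h1 := key 1
  simp only [zero_mul, add_zero, one_mul, Real.exp_add, ← mul_assoc] at h0 h1
  rw [h0] at h1
  have hne0 : gaussianCoord p'.1 * Real.exp (-p'.2 ^ 2) ≠ 0 := by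
    rcases hpos with h | h
    · positivity
    · rw [← h0]; positivity
  have hy : p.2 = p'.2 := Real.exp_injective (mul_left_cancel₀ hne0 h1)
  rw [hy] at h0
  have hx := strictAnti_gaussianCoord.injective
    (mul_right_cancel₀ (Real.exp_pos (-p'.2 ^ 2)).ne' h0)
  exact hne (Prod.ext hx hy)

section

open BoundedContinuousFunction in
-- The finite measures with densities `r⁺` and `r⁻` have equal integrals on a point-separating
-- algebra of bounded continuous functions, so they coincide. Thus `r⁺ = r⁻` almost everywhere, and
-- `r = 0` everywhere by continuity.
theorem eq_zero_of_integral_gaussianAlgebra {r : ℝ × ℝ → ℝ} (hr : Continuous r)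
    (hi : Integrable r) (h : ∀ f ∈ gaussianSubmonoid, ∫ p, f p * r p = 0) : r = 0 := by
  have hint : ∀ (f : (ℝ × ℝ) →ᵇ ℝ) {s : ℝ × ℝ → ℝ}, Integrable s → Integrable fun p => f p * s p :=
    fun f s hs => hs.bdd_mul (c := ‖f‖) f.continuous.aestronglyMeasurable
      (Eventually.of_forall fun p => f.norm_coe_le_norm p)
  have hA : ∀ f ∈ gaussianAlgebra, ∫ p, f p * r p = 0 := by
    intro f hf
    have hf' : f ∈ Submodule.span ℝ (gaussianSubmonoid : Set ((ℝ × ℝ) →ᵇ ℝ)) := by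
      have h2 : f ∈ Subalgebra.toSubmodule (Algebra.adjoin ℝ
        (gaussianSubmonoid : Set ((ℝ × ℝ) →ᵇ ℝ))) := hf
      -- The generators are closed under products, so the algebra is their linear span and linearity
      -- suffices.
      rwa [Algebra.adjoin_eq_span, Submonoid.closure_eq] at h2
    clear hf
    induction hf' using Submodule.span_induction with
    | mem f hf => exact h f hf
    | zero => simp
    | add f g _ _ hf hg =>
      simp only [BoundedContinuousFunction.add_apply, add_mul]
      rw [integral_add (hint f hi) (hint g hi), hf, hg, add_zero]
    | smul a f _ hf =>
      simp only [BoundedContinuousFunction.smul_apply, smul_eq_mul, mul_assoc]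
      rw [integral_const_mul, hf, mul_zero]
  have hpos : Integrable fun p => max (r p) 0 := hi.pos_part
  have hneg : Integrable fun p => max (-r p) 0 := hi.neg_part
  have hdens : ∀ {s : ℝ × ℝ → ℝ}, Continuous s → ∀ f : (ℝ × ℝ) →ᵇ ℝ,
      ∫ p, f p ∂(volume.withDensity fun p => ENNReal.ofReal (s p)) = ∫ p, f p * max (s p) 0 := by
    intro s hs f
    rw [integral_withDensity_eq_integral_toReal_smul (by fun_prop) (by simp)]
    congr 1 with p
    rw [ENNReal.toReal_ofReal', smul_eq_mul, mul_comm]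
  have hfin : ∀ {s : ℝ × ℝ → ℝ}, Integrable s →
      IsFiniteMeasure (volume.withDensity fun p => ENNReal.ofReal (s p)) := fun hs =>
    isFiniteMeasure_withDensity_ofReal hs.2
  have := hfin hi
  have : IsFiniteMeasure (volume.withDensity fun p => ENNReal.ofReal (-r p)) := hfin hi.neg
  have hrn : Continuous fun p => -r p := hr.neg
  have hmeas := ext_of_forall_mem_subalgebra_integral_eq_of_pseudoEMetric_complete_countable
    (P := volume.withDensity fun p => ENNReal.ofReal (r p))
    (P' := volume.withDensity fun p => ENNReal.ofReal (-r p)) separatesPoints_gaussianAlgebra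
    fun f hf => by
      have h0 := hA f hf
      rw [hdens hr, hdens hrn, ← sub_eq_zero, ← integral_sub (hint f hpos) (hint f hneg)]
      refine Eq.trans ?_ h0
      congr 1 with p
      rw [← mul_sub]
      congr 1
      rcases le_total 0 (r p) with h | h
      · rw [max_eq_left h, max_eq_right (by linarith), sub_zero]
      · rw [max_eq_right h, max_eq_left (by linarith)]
        ring
  have hfin' : ∫⁻ p, ENNReal.ofReal (r p) ≠ ⊤ := (hi.lintegral_lt_top).ne
  have hae := (withDensity_eq_iff (by fun_prop) (by fun_prop) hfin').1 hmeas
  refine (Continuous.ae_eq_iff_eq volume hr continuous_zero).1 ?_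
  filter_upwards [hae] with p hp
  rcases le_total 0 (r p) with h | h
  · rw [ENNReal.ofReal_of_nonpos (show -r p ≤ 0 by linarith), ENNReal.ofReal_eq_zero] at hp
    exact le_antisymm hp h
  · rw [ENNReal.ofReal_of_nonpos h, eq_comm, ENNReal.ofReal_eq_zero] at hp
    exact le_antisymm h (neg_nonpos.1 hp)

end

section

variable {m : ℂ} {W : ℝ × ℝ → ℂ} {M : ℝ}

/-- Apply the density result to the real and imaginary parts of `W`, times `x exp(-(x² + y²))`: this
weight gives integrability and is nonzero for `x > 0`. The artificial values of the test functions
for `x < 0` do not matter, as `W` vanishes there. -/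
theorem eq_zero_of_gaussianMoment (hW : Continuous W) (hM : ∀ p, ‖W p‖ ≤ M)
    (hW0 : ∀ p : ℝ × ℝ, p.1 ≤ 0 → W p = 0) (h : ∀ b l, 0 < l → gaussianMoment W b l = 0) :
    W = 0 := by
  have key : ∀ L : ℂ →L[ℝ] ℝ, ∀ p : ℝ × ℝ, L (W p) = 0 := by
    intro L
    have hL : ∀ (z : ℂ) (t : ℝ), L (z * t) = L z * t := fun z t => by
      rw [mul_comm, ← Complex.real_smul, map_smul, smul_eq_mul, mul_comm]
    have hr : (fun p : ℝ × ℝ => L (W p) * (p.1 * Real.exp (-1 * (p.1 ^ 2 + (p.2 - 0) ^ 2)))) = 0 := by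
      refine eq_zero_of_integral_gaussianAlgebra (by fun_prop) ?_ ?_
      · simpa only [hL] using L.integrable_comp (integrable_mul_gaussian hW hM one_pos 0)
      · rintro f ⟨k, c, -, hf⟩
        -- Completing the square: the weight raises `k` to `k + 1`, the linear term `c y` moves the
        -- centre to `b = c / (2l)`, and the constant `exp(l b²)` comes out.
        set l : ℝ := k + 1 with hl
        have hl0 : 0 < l := by positivity
        set b : ℝ := c / (2 * l) with hb
        have hc : c = 2 * l * b := by rw [hb]; field_simp
        have e : ∀ p : ℝ × ℝ,
            f p * (L (W p) * (p.1 * Real.exp (-1 * (p.1 ^ 2 + (p.2 - 0) ^ 2)))) =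
            Real.exp (l * b ^ 2) *
              L (W p * (p.1 * Real.exp (-l * (p.1 ^ 2 + (p.2 - b) ^ 2)) : ℝ)) := fun p => by
          rcases le_or_gt p.1 0 with hp | hp
          · simp [hW0 p hp]
          · rw [hf, hL, gaussianCoord_of_nonneg hp.le, ← Real.exp_nat_mul]
            have e2 : Real.exp (k * -p.1 ^ 2) * Real.exp (-k * p.2 ^ 2 + c * p.2) *
                Real.exp (-1 * (p.1 ^ 2 + (p.2 - 0) ^ 2)) =
                Real.exp (l * b ^ 2) * Real.exp (-l * (p.1 ^ 2 + (p.2 - b) ^ 2)) := by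
              rw [← Real.exp_add, ← Real.exp_add, ← Real.exp_add, hc, hl]
              congr 1
              ring
            linear_combination (L (W p) * p.1) * e2
        simp only [e]
        rw [integral_const_mul, L.integral_comp_comm (integrable_mul_gaussian hW hM hl0 b)]
        have := h b l hl0
        rw [gaussianMoment] at this
        rw [this, map_zero, mul_zero]
    intro p
    rcases le_or_gt p.1 0 with hp | hp
    · rw [hW0 p hp, map_zero]
    · have := congrFun hr p
      simpa [hp.ne', Real.exp_ne_zero] using this
  funext p
  exact Complex.ext (key Complex.reCLM p) (key Complex.imCLM p)

end

/-! ### Uniqueness and the Poisson formula -/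

section

variable {m : ℂ} {U V : ℝ × ℝ → ℂ} {u : ℝ → ℝ} {M : ℝ}

theorem partialX_congr (h : Set.EqOn U V rightHalfPlane) :
    Set.EqOn (partialX U) (partialX V) rightHalfPlane := fun p hp => by
  refine Filter.EventuallyEq.deriv_eq ?_
  filter_upwards [lt_mem_nhds (show 0 < p.1 from hp)] with t ht using h ht

theorem partialY_congr (h : Set.EqOn U V rightHalfPlane) :
    Set.EqOn (partialY U) (partialY V) rightHalfPlane := fun p hp => by
  refine Filter.EventuallyEq.deriv_eq (Eventually.of_forall fun t => ?_)
  exact h (show 0 < p.1 from hp)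

theorem IsAxisymmetricPotential.congr (hU : IsAxisymmetricPotential m U)
    (h : Set.EqOn V U rightHalfPlane) : IsAxisymmetricPotential m V := by
  refine ⟨hU.1.congr h, fun p hp => ?_⟩
  rw [weinsteinOp, partialX_congr (partialX_congr h) hp, partialY_congr (partialY_congr h) hp,
    partialX_congr h hp]
  exact hU.2 p hp

theorem IsAxisymmetricPotential.sub (hU : IsAxisymmetricPotential m U)
    (hV : IsAxisymmetricPotential m V) : IsAxisymmetricPotential m fun p => U p - V p := by
  have c1 : ∀ {U : ℝ × ℝ → ℂ}, IsAxisymmetricPotential m U → ContDiffOn ℝ 1 U rightHalfPlane :=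
    fun h => h.1.of_le (by norm_num)
  have cX : ∀ {U : ℝ × ℝ → ℂ}, IsAxisymmetricPotential m U →
      ContDiffOn ℝ 1 (partialX U) rightHalfPlane := fun h => by
    exact_mod_cast contDiffOn_partialX (n := 1) (by exact_mod_cast h.1)
  have cY : ∀ {U : ℝ × ℝ → ℂ}, IsAxisymmetricPotential m U →
      ContDiffOn ℝ 1 (partialY U) rightHalfPlane := fun h => by
    exact_mod_cast contDiffOn_partialY (n := 1) (by exact_mod_cast h.1)
  have eX : ∀ {f g : ℝ × ℝ → ℂ}, ContDiffOn ℝ 1 f rightHalfPlane →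
      ContDiffOn ℝ 1 g rightHalfPlane → Set.EqOn (partialX fun p => f p - g p)
        (fun p => partialX f p - partialX g p) rightHalfPlane := fun hf hg p hp =>
    ((hasDerivAt_partialX hf hp).1.sub (hasDerivAt_partialX hg hp).1).deriv
  have eY : ∀ {f g : ℝ × ℝ → ℂ}, ContDiffOn ℝ 1 f rightHalfPlane →
      ContDiffOn ℝ 1 g rightHalfPlane → Set.EqOn (partialY fun p => f p - g p)
        (fun p => partialY f p - partialY g p) rightHalfPlane := fun hf hg p hp =>
    ((hasDerivAt_partialY hf hp).1.sub (hasDerivAt_partialY hg hp).1).deriv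
  refine ⟨hU.1.sub hV.1, fun p hp => ?_⟩
  rw [weinsteinOp, partialX_congr (eX (c1 hU) (c1 hV)) hp, partialY_congr (eY (c1 hU) (c1 hV)) hp,
    eX (c1 hU) (c1 hV) hp, eX (cX hU) (cX hV) hp, eY (cY hU) (cY hV) hp]
  have h1 := hU.2 p hp
  have h2 := hV.2 p hp
  rw [weinsteinOp] at h1 h2
  linear_combination h1 - h2

theorem continuous_indicator_rightHalfPlane (hU : ContinuousOn U rightHalfPlane)
    (h0 : HasBoundaryValues U fun _ => 0) : Continuous (rightHalfPlane.indicator U) := by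
  rw [continuous_iff_continuousAt]
  intro p
  rcases lt_trichotomy p.1 0 with hp | hp | hp
  · have : rightHalfPlane.indicator U =ᶠ[𝓝 p] fun _ => 0 := by
      filter_upwards [continuous_fst.continuousAt.eventually (gt_mem_nhds hp)] with q hq
      exact Set.indicator_of_notMem (fun h : q ∈ rightHalfPlane =>
        lt_asymm (show 0 < q.1 from h) hq) _
    exact this.continuousAt
  · have hz : rightHalfPlane.indicator U p = 0 :=
      Set.indicator_of_notMem (fun h : p ∈ rightHalfPlane => (show 0 < p.1 from h).ne' hp) _
    rw [ContinuousAt, hz, ← nhdsWithin_univ, ← Set.union_compl_self rightHalfPlane,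
      nhdsWithin_union, tendsto_sup]
    constructor
    · have h := h0 p.2
      rw [show ((0 : ℝ), p.2) = p from Prod.ext hp.symm rfl, Complex.ofReal_zero] at h
      refine h.congr' ?_
      filter_upwards [self_mem_nhdsWithin] with q hq
      exact (Set.indicator_of_mem hq U).symm
    · refine tendsto_const_nhds.congr' ?_
      filter_upwards [self_mem_nhdsWithin] with q hq
      exact (Set.indicator_of_notMem hq U).symm
  · have hmem := isOpen_rightHalfPlane.mem_nhds (show p ∈ rightHalfPlane from hp)
    have : rightHalfPlane.indicator U =ᶠ[𝓝 p] U := by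
      filter_upwards [hmem] with q hq using Set.indicator_of_mem hq U
    exact (continuousAt_congr this).2 (hU.continuousAt hmem)

theorem eqOn_zero_of_isDirichletSolution_zero (hm : m.re < 1)
    (hU : IsDirichletSolution m (fun _ => 0) U) : ∀ p ∈ rightHalfPlane, U p = 0 := by
  obtain ⟨hpot, hinf, hbd⟩ := hU
  set W := rightHalfPlane.indicator U with hWdef
  have hWU : Set.EqOn W U rightHalfPlane := fun p hp => Set.indicator_of_mem hp U
  have hW : Continuous W := continuous_indicator_rightHalfPlane hpot.1.continuousOn hbd
  have hW0 : ∀ p : ℝ × ℝ, p.1 ≤ 0 → W p = 0 := fun p hp =>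
    Set.indicator_of_notMem (fun h : p ∈ rightHalfPlane => not_lt.2 hp h) U
  -- Decay bounds `W` off a compact set. That set may meet the boundary, so continuity of the
  -- extended function is what bounds `W` on it.
  obtain ⟨M, hM⟩ : ∃ M, ∀ p, ‖W p‖ ≤ M := by
    have h1 := (Metric.tendsto_nhds.1 hinf) 1 one_pos
    rw [eventually_inf_principal] at h1
    obtain ⟨K, hK, hKs⟩ := mem_cocompact.1 h1
    obtain ⟨C, hC⟩ := hK.exists_bound_of_continuousOn hW.continuousOn
    refine ⟨max C 1, fun p => ?_⟩
    by_cases hp : p ∈ K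
    · exact (hC p hp).trans (le_max_left _ _)
    · refine le_trans ?_ (le_max_right _ _)
      by_cases hpH : p ∈ rightHalfPlane
      · rw [hWU hpH]
        simpa using (hKs hp hpH : dist (U p) 0 < 1).le
      · rw [hWdef, Set.indicator_of_notMem hpH, norm_zero]
        exact zero_le_one
  have hz := eq_zero_of_gaussianMoment hW hM hW0 fun b l hl =>
    gaussianMoment_eq_zero hm (hpot.congr hWU) hW hM hW0 b hl
  intro p hp
  rw [← hWU hp, hz]
  rfl

/-- `U - P` has zero data. Its decay needs `u → 0`, which the existence of `U` itself supplies. -/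
theorem IsDirichletSolution.eqOn_poissonIntegral (hm : m.re < 1) (hu : Continuous u)
    (hb : ∀ y, |u y| ≤ M) (hU : IsDirichletSolution m u U) :
    Set.EqOn U (poissonIntegral m u) rightHalfPlane := by
  have hP := vanishesAtInfinity_poissonIntegral hm hb
    (tendsto_zero_of_vanishesAtInfinity hU.2.1 hU.2.2)
  have h := eqOn_zero_of_isDirichletSolution_zero hm
    (U := fun p => U p - poissonIntegral m u p)
    ⟨hU.1.sub (isAxisymmetricPotential_poissonIntegral hm hu hb),
      by simpa [VanishesAtInfinity] using hU.2.1.sub hP,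
      fun y => by simpa using (hU.2.2 y).sub (hasBoundaryValues_poissonIntegral hm hu hb y)⟩
  exact fun p hp => sub_eq_zero.1 (h p hp)

end

end

theorem mainTheorem6 (m : ℂ) (hm : m.re < 1) (u : ℝ → ℝ) (hu : Continuous u)
    (hb : ∃ M : ℝ, ∀ y : ℝ, |u y| ≤ M) :
    -- the two expressions of the constant agree
    poissonConst m =
        (1 - m) / (2 * (Real.pi : ℂ)) * ∫ θ in (0 : ℝ)..Real.pi, (Real.sin θ : ℂ) ^ (1 - m) ∧
    -- the Poisson integral converges, is an axisymmetric potential, and has boundary values `u`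
    (∀ p ∈ rightHalfPlane, Integrable (poissonIntegrand m u p)) ∧
    IsAxisymmetricPotential m (poissonIntegral m u) ∧
    HasBoundaryValues (poissonIntegral m u) u ∧
    -- existence and uniqueness of the potential that also tends to `0` at infinity
    ((∃ U : ℝ × ℝ → ℂ, IsDirichletSolution m u U ∧
        ∀ V : ℝ × ℝ → ℂ, IsDirichletSolution m u V → Set.EqOn V U rightHalfPlane) ↔
      Tendsto u (cocompact ℝ) (𝓝 0)) ∧
    -- any such potential (hence at most one) is given by the Poisson formula
    (∀ U : ℝ × ℝ → ℂ, IsDirichletSolution m u U →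
      Set.EqOn U (poissonIntegral m u) rightHalfPlane) := by
  obtain ⟨M, hM⟩ := hb
  refine ⟨poissonConst_eq_integral_sin hm, fun p hp => integrable_poissonIntegrand hm hu hM hp,
    isAxisymmetricPotential_poissonIntegral hm hu hM, hasBoundaryValues_poissonIntegral hm hu hM,
    ⟨?_, fun h0 => ?_⟩, fun U hU => hU.eqOn_poissonIntegral hm hu hM⟩
  · rintro ⟨U, hU, -⟩
    exact tendsto_zero_of_vanishesAtInfinity hU.2.1 hU.2.2
  · exact ⟨poissonIntegral m u, ⟨isAxisymmetricPotential_poissonIntegral hm hu hM,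
      vanishesAtInfinity_poissonIntegral hm hM h0, hasBoundaryValues_poissonIntegral hm hu hM⟩,
      fun V hV => hV.eqOn_poissonIntegral hm hu hM⟩
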